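/- Let $F$ be a field of characteristic zero. Let $(A,\Delta,d)$ be a differential BV-algebra over $F$: $A=\bigoplus_{n\in\mathbb Z}A^n$ is a graded commutative associative algebra (not necessarily unital) with a bracket $[\,,\,]$ of degree $-1$ that is a graded Lie bracket for the grading $g_j=A^{1-j}$ (no Leibniz rule of the bracket with respect to the product is required); $\Delta$ is an operator of degree $-1$ with $\Delta^2=0$ and $[a,b]=(-1)^{|a|}\bigl(\Delta(ab)-(\Delta a)b-(-1)^{|a|}a(\Delta b)\bigr)$ for homogeneous $a$; and $d$ is a differential of degree $+1$ on $A$ that is a derivation of the product and satisfies $\Delta d+d\Delta=0$. Write $g$ for $A$ as a differential graded Lie algebra with the grading $g_j=A^{1-j}$ (so that $[\,,\,]$ has degree $0$ and $d$ has degree $-1$), $H(g)=H(g,d)$, and $m=(\operatorname{Ker}\Delta,\,d|_{\operatorname{Ker}\Delta})$. Assume that $(A,\Delta,d)$ satisfies the statement of the Kählerian formality ($\partial\bar\partial$) lemma: the inclusion $m\hookrightarrow(g,d)$ and the projection $m\to (H(g,\Delta),0)$ (in particular, the latter is a chain map) induce isomorphisms on homology. Let $\mathrm{proj}:m\to H(g)$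 be the composite of the projection $\operatorname{Ker}\Delta\to H(g,\Delta)$ with the resulting isomorphisms $H(g,\Delta)\cong H(m)\cong H(g)$. Let $\pi=\mathrm{proj}$ be extended to a contraction of chain complexes of $m$ onto $(H(g),0)$, that is, let $\nabla:H(g)\to m$ be a chain map of degree $0$ and $h:m\to m$ a linear map of degree $+1$ with $\pi\nabla=\mathrm{id}$, $dh+hd=\nabla\pi-\mathrm{id}$, $\pi h=0$, $h\nabla=0$ and $hh=0$ ($\pi$ being a chain map of degree $0$). Let $S^c[sH(g)]=\bigoplus_{k\ge 0}S^c_k[sH(g)]$ be the graded symmetric coalgebra (with the signed unshuffle coproduct and zero differential) on the suspension $sH(g)$, where $(sH(g))_n=H(g)_{n-1}$; for linear maps $a,b:S^c[sH(g)]\to g$ let $[a,b]$ be their cup bracket, the composite of the coproduct, $a\otimes b$ (with the Koszul sign) and the bracket of $g$; and let $\tau_{H}:S^c[sH(g)]\to H(g)$ be the universal twisting cochain of the abelian graded Lie algebra $H(g)$, i.e. $\tau_H(sx)=x$ for $x\in H(g)$ and $\tau_H=0$ on $S^c_k[sH(g)]$ for $k\neq1$. Then $H(g)$ is abelian as a graded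 Lie algebra, i.e. the bracket induced by $[\,,\,]$ on $H(g)$ is zero, and the data determine a linear map $\tau:S^c[sH(g)]\to g$ of degree $-1$ that vanishes on $1\in S^c_0[sH(g)]$ and is a solution of the master equation $$d\tau=\tfrac12[\tau,\tau],$$ namely the one given recursively by $\tau=\nabla\tau_H-h\bigl(\tfrac12[\tau,\tau]\bigr)$, such that the following hold: 1. the values of $\tau$ lie in $m$, that is, $\Delta\circ\tau=0$; 2. $\pi\tau=\tau_H$; 3. for every $k\ge2$, the restriction $\tau_k$ of $\tau$ to $S^c_k[sH(g)]$ takes values in $\operatorname{Im}(\Delta)$. -/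

import Mathlib

open DirectSum

noncomputable section

/-! ## Graded vector spaces -/

section Graded

variable {F V W : Type*} [Field F] [AddCommGroup V] [Module F V] [AddCommGroup W] [Module F W]

/-- Relabelling of the degrees of a graded vector space along a bijection of `ℤ`. -/
def regrade (e : ℤ ≃ ℤ) (𝒱 : ℤ → Submodule F V) : ℤ → Submodule F V := fun n => 𝒱 (e n)

instance regradeDecomposition (e : ℤ ≃ ℤ) (𝒱 : ℤ → Submodule F V) [Decomposition 𝒱] :
    Decomposition (regrade e 𝒱) :=
  IsInternal.chooseDecomposition _ <| by
    have h := (isInternal_submodule_iff_iSupIndep_and_iSup_eq_top 𝒱).1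
      (Decomposition.isInternal 𝒱)
    refine (isInternal_submodule_iff_iSupIndep_and_iSup_eq_top _).2 ⟨h.1.comp e.injective, ?_⟩
    exact (e.iSup_comp (g := 𝒱)).trans h.2

/-- The suspension `sV`: the same vector space, with `(sV)_n = V_{n-1}`. -/
def suspend (𝒱 : ℤ → Submodule F V) : ℤ → Submodule F V := regrade (Equiv.subRight 1) 𝒱

instance suspendDecomposition (𝒱 : ℤ → Submodule F V) [Decomposition 𝒱] :
    Decomposition (suspend 𝒱) := regradeDecomposition _ 𝒱

theorem mem_suspend (𝒱 : ℤ → Submodule F V) (n : ℤ) (x : V) :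
    x ∈ suspend 𝒱 n ↔ x ∈ 𝒱 (n - 1) := Iff.rfl

/-- The Koszul sign operator `x ↦ (-1)^(q|x|) x`. -/
def koszulSign (𝒱 : ℤ → Submodule F V) [Decomposition 𝒱] (q : ℤ) : V →ₗ[F] V :=
  (DirectSum.toModule F ℤ V fun n => ((-1 : F) ^ (q * n)) • (𝒱 n).subtype) ∘ₗ
    (decomposeLinearEquiv 𝒱).toLinearMap

theorem koszulSign_of_mem (𝒱 : ℤ → Submodule F V) [Decomposition 𝒱] (q : ℤ) {n : ℤ} {x : V}
    (hx : x ∈ 𝒱 n) : koszulSign 𝒱 q x = ((-1 : F) ^ (q * n)) • x := by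
  simp only [koszulSign, LinearMap.comp_apply, LinearEquiv.coe_coe, decomposeLinearEquiv_apply]
  rw [decompose_of_mem 𝒱 hx, ← lof_eq_of F, toModule_lof]
  simp

/-- The projection onto the component of degree `n`. -/
def gradedProj (𝒱 : ℤ → Submodule F V) [Decomposition 𝒱] (n : ℤ) : V →ₗ[F] V :=
  (𝒱 n).subtype ∘ₗ DirectSum.component F ℤ (fun i => 𝒱 i) n ∘ₗ
    (decomposeLinearEquiv 𝒱).toLinearMap

theorem gradedProj_apply (𝒱 : ℤ → Submodule F V) [Decomposition 𝒱] (n : ℤ) (x : V) :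
    gradedProj 𝒱 n x = (decompose 𝒱 x n : V) := rfl

theorem gradedProj_of_degree (𝒱 : ℤ → Submodule F V) [Decomposition 𝒱] (f : V →ₗ[F] V) (e : ℤ)
    (hf : ∀ n, ∀ x ∈ 𝒱 n, f x ∈ 𝒱 (n + e)) (n : ℤ) (x : V) :
    f (gradedProj 𝒱 n x) = gradedProj 𝒱 (n + e) (f x) := by
  induction x using Decomposition.inductionOn 𝒱 with
  | zero => simp
  | add a b ha hb => simp [ha, hb]
  | @homogeneous i a =>
    rw [gradedProj_apply, gradedProj_apply]
    by_cases h : i = n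
    · subst h
      rw [decompose_of_mem_same 𝒱 a.2, decompose_of_mem_same 𝒱 (hf i a a.2)]
    · rw [decompose_of_mem_ne 𝒱 a.2 h, map_zero, decompose_of_mem_ne 𝒱 (hf i a a.2)]
      omega

/-! ## Homology of a differential -/

/-- The homology `Ker f / Im f` of a differential `f`. -/
abbrev Homology (f : V →ₗ[F] V) : Type _ :=
  (LinearMap.ker f) ⧸ ((LinearMap.range f).submoduleOf (LinearMap.ker f))

/-- The homology class of a cycle. -/
abbrev homologyClass (f : V →ₗ[F] V) : LinearMap.ker f →ₗ[F] Homology f :=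
  ((LinearMap.range f).submoduleOf (LinearMap.ker f)).mkQ

/-- The map induced on homology by a chain map. -/
def homologyMap (f : V →ₗ[F] V) (g : W →ₗ[F] W) (φ : V →ₗ[F] W) (h : g ∘ₗ φ = φ ∘ₗ f) :
    Homology f →ₗ[F] Homology g :=
  Submodule.mapQ _ _
    (φ.restrict (p := LinearMap.ker f) (q := LinearMap.ker g) (fun x hx => by
      have := LinearMap.congr_fun h x
      simp only [LinearMap.comp_apply] at this
      rw [LinearMap.mem_ker, this, LinearMap.mem_ker.1 hx, map_zero]))
    (by
      rintro ⟨x, hx⟩ ⟨y, rfl⟩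
      exact ⟨φ y, LinearMap.congr_fun h y⟩)

/-- The map induced on homology by a chain map `(V, f) → (W, 0)`. -/
def homologyDesc (f : V →ₗ[F] V) (φ : V →ₗ[F] W) (h : φ ∘ₗ f = 0) : Homology f →ₗ[F] W :=
  Submodule.liftQ _ (φ ∘ₗ (LinearMap.ker f).subtype) (by
    rintro ⟨x, hx⟩ ⟨y, rfl⟩
    exact LinearMap.congr_fun h y)

/-- The grading of the homology: classes of homogeneous cycles. -/
def homologyGrading (𝒱 : ℤ → Submodule F V) (f : V →ₗ[F] V) (n : ℤ) :
    Submodule F (Homology f) :=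
  ((𝒱 n).submoduleOf (LinearMap.ker f)).map (homologyClass f)

/-- The homology of a homogeneous differential is a graded vector space. -/
@[reducible]
def homologyDecomposition (𝒱 : ℤ → Submodule F V) [Decomposition 𝒱] (f : V →ₗ[F] V) (e : ℤ)
    (hf : ∀ n, ∀ x ∈ 𝒱 n, f x ∈ 𝒱 (n + e)) : Decomposition (homologyGrading 𝒱 f) :=
  IsInternal.chooseDecomposition _ <| by
    have hker : ∀ n, ∀ x ∈ LinearMap.ker f, gradedProj 𝒱 n x ∈ LinearMap.ker f := by
      intro n x hx
      rw [LinearMap.mem_ker, gradedProj_of_degree 𝒱 f e hf, LinearMap.mem_ker.1 hx, map_zero]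
    let p : ℤ → Homology f →ₗ[F] Homology f := fun n =>
      Submodule.mapQ _ _ ((gradedProj 𝒱 n).restrict (hker n)) (by
        rintro ⟨x, hx⟩ ⟨y, rfl⟩
        refine ⟨gradedProj 𝒱 (n - e) y, ?_⟩
        rw [gradedProj_of_degree 𝒱 f e hf, sub_add_cancel]
        rfl)
    have hp : ∀ n i, ∀ x ∈ homologyGrading 𝒱 f i, p n x = if i = n then x else 0 := by
      rintro n i _ ⟨⟨x, hx⟩, hxi, rfl⟩
      have hxi' : x ∈ 𝒱 i := hxi
      change homologyClass f ⟨gradedProj 𝒱 n x, hker n x hx⟩ = _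
      split_ifs with h
      · subst h
        congr 2
        exact decompose_of_mem_same 𝒱 hxi'
      · convert map_zero (homologyClass f)
        exact decompose_of_mem_ne 𝒱 hxi' h
    constructor
    · rw [injective_iff_map_eq_zero]
      intro z hz
      have key : ∀ n (z : ⨁ i, homologyGrading 𝒱 f i),
          p n (DirectSum.coeAddMonoidHom (homologyGrading 𝒱 f) z) = (z n : Homology f) := by
        intro n z
        induction z using DirectSum.induction_on with
        | zero => simp
        | add a b ha hb => simp [ha, hb]
        | of i x =>
          rw [DirectSum.coeAddMonoidHom_of, hp n i x x.2]
          split_ifs with h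
          · subst h; simp
          · rw [DirectSum.of_eq_of_ne _ _ _ (Ne.symm h)]; rfl
      refine DFinsupp.ext fun n => Subtype.ext ?_
      have := key n z
      rw [hz, map_zero] at this
      exact this.symm
    · intro y
      obtain ⟨⟨x, hx⟩, rfl⟩ := Submodule.mkQ_surjective _ y
      classical
      refine ⟨∑ i ∈ (decompose 𝒱 x).support, DirectSum.of (fun i => homologyGrading 𝒱 f i) i
        ⟨homologyClass f ⟨gradedProj 𝒱 i x, hker i x hx⟩,
          ⟨_, (decompose 𝒱 x i).2, rfl⟩⟩, ?_⟩
      rw [map_sum]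
      simp only [DirectSum.coeAddMonoidHom_of]
      rw [← map_sum]
      congr 1
      refine Subtype.ext ?_
      rw [AddSubmonoidClass.coe_finsetSum]
      exact sum_support_decompose 𝒱 x

end Graded

/-! ## Contractions -/

/-- A contraction of the chain complex `(N, dN)` onto the chain complex `(M, dM)`
(differentials of degree `-1`). -/
structure Contraction {F N M : Type*} [Field F] [AddCommGroup N] [Module F N]
    [AddCommGroup M] [Module F M] (dN : N →ₗ[F] N) (𝒩 : ℤ → Submodule F N)
    (dM : M →ₗ[F] M) (ℳ : ℤ → Submodule F M) where
  /-- The projection. -/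
  π : N →ₗ[F] M
  /-- The inclusion. -/
  nabla : M →ₗ[F] N
  /-- The homotopy. -/
  h : N →ₗ[F] N
  π_mem : ∀ n, ∀ x ∈ 𝒩 n, π x ∈ ℳ n
  nabla_mem : ∀ n, ∀ x ∈ ℳ n, nabla x ∈ 𝒩 n
  h_mem : ∀ n, ∀ x ∈ 𝒩 n, h x ∈ 𝒩 (n + 1)
  π_chain : dM ∘ₗ π = π ∘ₗ dN
  nabla_chain : dN ∘ₗ nabla = nabla ∘ₗ dM
  π_nabla : π ∘ₗ nabla = LinearMap.id
  homotopy : dN ∘ₗ h + h ∘ₗ dN = nabla ∘ₗ π - LinearMap.id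
  π_h : π ∘ₗ h = 0
  h_nabla : h ∘ₗ nabla = 0
  h_h : h ∘ₗ h = 0

/-! ## The graded symmetric coalgebra -/

section GradedSym

variable {F V : Type*} [Field F] [AddCommGroup V] [Module F V]

/-- The relation `v w = (-1)^(|v||w|) w v` in the tensor algebra. -/
inductive GradedSymRel (𝒱 : ℤ → Submodule F V) : TensorAlgebra F V → TensorAlgebra F V → Prop
  | comm {i j : ℤ} {v w : V} (hv : v ∈ 𝒱 i) (hw : w ∈ 𝒱 j) :
      GradedSymRel 𝒱 (TensorAlgebra.ι F v * TensorAlgebra.ι F w)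
        (((-1 : F) ^ (i * j)) • (TensorAlgebra.ι F w * TensorAlgebra.ι F v))

/-- The underlying space of the graded symmetric coalgebra `S^c[V]` of a graded vector space:
the space of graded commutative words `v₁ ⋯ v_k`. -/
def GradedSym (𝒱 : ℤ → Submodule F V) : Type _ := RingQuot (GradedSymRel 𝒱)

namespace GradedSym

variable (𝒱 : ℤ → Submodule F V)

instance instRing : Ring (GradedSym 𝒱) := inferInstanceAs (Ring (RingQuot (GradedSymRel 𝒱)))

instance instAlgebra : Algebra F (GradedSym 𝒱) :=
  inferInstanceAs (Algebra F (RingQuot (GradedSymRel 𝒱)))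

/-- The inclusion of `V` as the words of length one. -/
def ι : V →ₗ[F] GradedSym 𝒱 :=
  (RingQuot.mkAlgHom F (GradedSymRel 𝒱)).toLinearMap ∘ₗ TensorAlgebra.ι F

theorem ι_comm {i j : ℤ} {v w : V} (hv : v ∈ 𝒱 i) (hw : w ∈ 𝒱 j) :
    ι 𝒱 v * ι 𝒱 w = ((-1 : F) ^ (i * j)) • (ι 𝒱 w * ι 𝒱 v) := by
  have h := RingQuot.mkAlgHom_rel F (GradedSymRel.comm hv hw)
  rw [map_smul, map_mul, map_mul] at h
  exact h

/-- An algebra map out of `GradedSym 𝒱` is given by a linear map on `V` whose values commute in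
the graded sense. -/
def lift {R : Type*} [Semiring R] [Algebra F R] (f : V →ₗ[F] R)
    (hf : ∀ i j, ∀ v ∈ 𝒱 i, ∀ w ∈ 𝒱 j, f v * f w = ((-1 : F) ^ (i * j)) • (f w * f v)) :
    GradedSym 𝒱 →ₐ[F] R :=
  RingQuot.liftAlgHom F ⟨TensorAlgebra.lift F f, by
    rintro _ _ ⟨hv, hw⟩
    simpa using hf _ _ _ hv _ hw⟩

theorem lift_ι {R : Type*} [Semiring R] [Algebra F R] (f : V →ₗ[F] R)
    (hf : ∀ i j, ∀ v ∈ 𝒱 i, ∀ w ∈ 𝒱 j, f v * f w = ((-1 : F) ^ (i * j)) • (f w * f v)) (v : V) :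
    lift 𝒱 f hf (ι 𝒱 v) = f v := by
  have := RingQuot.liftAlgHom_mkAlgHom_apply F (TensorAlgebra.lift F f)
    (s := GradedSymRel 𝒱) (by
      rintro _ _ ⟨hv, hw⟩
      simpa using hf _ _ _ hv _ hw) (TensorAlgebra.ι F v)
  rw [TensorAlgebra.lift_ι_apply] at this
  exact this

theorem algHom_ext {R : Type*} [Semiring R] [Algebra F R] {f g : GradedSym 𝒱 →ₐ[F] R}
    (h : ∀ v, f (ι 𝒱 v) = g (ι 𝒱 v)) : f = g := by
  refine RingQuot.ringQuot_ext' (S := F) (s := GradedSymRel 𝒱) f g ?_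
  refine TensorAlgebra.hom_ext (LinearMap.ext fun v => ?_)
  exact h v

/-- The words of length `k`: the component `S^c_k[V]`. -/
def power (k : ℕ) : Submodule F (GradedSym 𝒱) := LinearMap.range (ι 𝒱) ^ k

/-- The elements of total degree `n`: the span of the words `v₁ ⋯ v_k` in homogeneous elements
with `|v₁| + ⋯ + |v_k| = n`. -/
def degree (n : ℤ) : Submodule F (GradedSym 𝒱) :=
  Submodule.span F {x | ∃ l : List (Σ i, 𝒱 i),
    (l.map Sigma.fst).sum = n ∧ (l.map fun p => ι 𝒱 (p.2 : V)).prod = x}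

instance degreeGradedMonoid : SetLike.GradedMonoid (degree 𝒱) where
  one_mem := Submodule.subset_span ⟨[], rfl, rfl⟩
  mul_mem i j x y hx hy := by
    have h : degree 𝒱 i * degree 𝒱 j ≤ degree 𝒱 (i + j) := by
      rw [degree, degree, Submodule.span_mul_span]
      refine Submodule.span_mono ?_
      rintro _ ⟨_, ⟨l, rfl, rfl⟩, _, ⟨m, rfl, rfl⟩, rfl⟩
      exact ⟨l ++ m, by simp, by simp⟩
    exact h (Submodule.mul_mem_mul hx hy)

theorem ι_mem_degree {i : ℤ} {v : V} (hv : v ∈ 𝒱 i) : ι 𝒱 v ∈ degree 𝒱 i :=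
  Submodule.subset_span ⟨[⟨i, v, hv⟩], by simp, by simp⟩

/-- The projection `S^c[V] → S^c_1[V] = V`: it is the identity on words of length one and zero on
words of any other length. -/
def proj₁ : GradedSym 𝒱 →ₗ[F] V :=
  letI : Module Fᵐᵒᵖ V := Module.compHom _ ((RingHom.id F).fromOpposite mul_comm)
  haveI : IsCentralScalar F V := ⟨fun _ _ => rfl⟩
  (TrivSqZeroExt.sndHom F V) ∘ₗ
    (lift 𝒱 (TrivSqZeroExt.inrHom F V) (by
      intro i j v _ w _
      simp [TrivSqZeroExt.inr_mul_inr])).toLinearMap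

theorem proj₁_ι (v : V) : proj₁ 𝒱 (ι 𝒱 v) = v := by
  simp [proj₁, lift_ι]

theorem proj₁_one : proj₁ 𝒱 1 = 0 := by
  let _ : Module Fᵐᵒᵖ V := Module.compHom _ ((RingHom.id F).fromOpposite mul_comm)
  have _ : IsCentralScalar F V := ⟨fun _ _ => rfl⟩
  have h := map_one (lift 𝒱 (R := TrivSqZeroExt F V) (TrivSqZeroExt.inrHom F V) (by
      intro i j v _ w _
      simp [TrivSqZeroExt.inr_mul_inr]))
  exact congrArg TrivSqZeroExt.snd h

theorem proj₁_ι_mul_ι_mul (v w : V) (x : GradedSym 𝒱) :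
    proj₁ 𝒱 (ι 𝒱 v * (ι 𝒱 w * x)) = 0 := by
  simp [proj₁, lift_ι]

theorem proj₁_power (k : ℕ) (hk : k ≠ 1) (x : GradedSym 𝒱) (hx : x ∈ power 𝒱 k) :
    proj₁ 𝒱 x = 0 := by
  match k, hk, hx with
  | 0, _, hx =>
    rw [power, pow_zero, Submodule.mem_one] at hx
    obtain ⟨c, rfl⟩ := hx
    rw [Algebra.algebraMap_eq_smul_one, map_smul, proj₁_one, smul_zero]
  | k + 2, _, hx =>
    rw [power, pow_succ', pow_succ'] at hx
    refine Submodule.mul_induction_on hx ?_ ?_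
    · rintro _ ⟨v, rfl⟩ y hy
      refine Submodule.mul_induction_on hy ?_ ?_
      · rintro _ ⟨w, rfl⟩ z _
        exact proj₁_ι_mul_ι_mul 𝒱 v w z
      · intro a b ha hb
        rw [mul_add, map_add, ha, hb, add_zero]
    · intro a b ha hb
      rw [map_add, ha, hb, add_zero]

variable [Decomposition 𝒱]

/-- The inclusion of `V`, split into its homogeneous components. -/
def toDegree : V →ₗ[F] ⨁ n, degree 𝒱 n :=
  (DirectSum.toModule F ℤ _ fun n =>
    DirectSum.lof F ℤ (fun n => degree 𝒱 n) n ∘ₗ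
      ((ι 𝒱 ∘ₗ (𝒱 n).subtype).codRestrict (degree 𝒱 n) fun v => ι_mem_degree 𝒱 v.2)) ∘ₗ
    (decomposeLinearEquiv 𝒱).toLinearMap

theorem toDegree_of_mem {i : ℤ} {v : V} (hv : v ∈ 𝒱 i) :
    toDegree 𝒱 v = DirectSum.of (fun n => degree 𝒱 n) i ⟨ι 𝒱 v, ι_mem_degree 𝒱 hv⟩ := by
  simp only [toDegree, LinearMap.comp_apply, LinearEquiv.coe_coe, decomposeLinearEquiv_apply]
  rw [decompose_of_mem 𝒱 hv, ← lof_eq_of F, toModule_lof, ← lof_eq_of F]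
  rfl

theorem toDegree_comm (i j : ℤ) (v : V) (hv : v ∈ 𝒱 i) (w : V) (hw : w ∈ 𝒱 j) :
    toDegree 𝒱 v * toDegree 𝒱 w = ((-1 : F) ^ (i * j)) • (toDegree 𝒱 w * toDegree 𝒱 v) := by
  rw [toDegree_of_mem 𝒱 hv, toDegree_of_mem 𝒱 hw, DirectSum.of_mul_of, DirectSum.of_mul_of,
    ← lof_eq_of F, ← lof_eq_of F, ← map_smul, lof_eq_of, lof_eq_of]
  refine DirectSum.of_eq_of_gradedMonoid_eq (Sigma.subtype_ext (add_comm i j) ?_)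
  exact ι_comm 𝒱 hv hw

/-- The total degree is an algebra grading. -/
instance gradedAlgebra : GradedAlgebra (degree 𝒱) :=
  GradedAlgebra.ofAlgHom (degree 𝒱) (lift 𝒱 (toDegree 𝒱) (toDegree_comm 𝒱))
    (by
      refine algHom_ext 𝒱 fun v => ?_
      induction v using Decomposition.inductionOn 𝒱 with
      | zero => simp
      | add a b ha hb => rw [map_add, map_add, map_add, ha, hb]
      | homogeneous a =>
        rw [AlgHom.comp_apply, lift_ι, toDegree_of_mem 𝒱 a.2, DirectSum.coeAlgHom_of]
        rfl)
    (by
      rintro n ⟨x, hx⟩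
      induction hx using Submodule.span_induction with
      | mem x hx =>
        obtain ⟨l, rfl, rfl⟩ := hx
        induction l with
        | nil =>
          simp only [List.map_nil, List.prod_nil, map_one]
          rfl
        | cons p l ih =>
          simp only [List.map_cons, List.prod_cons, map_mul]
          rw [ih, lift_ι, toDegree_of_mem 𝒱 p.2.2, DirectSum.of_mul_of]
          rfl
      | zero =>
        rw [map_zero]
        exact (map_zero (DirectSum.of (fun n => degree 𝒱 n) n)).symm
      | add x y hx hy ihx ihy =>
        rw [map_add, ihx, ihy, ← map_add]
        rfl
      | smul c x hx ih =>
        rw [map_smul, ih, ← lof_eq_of F, ← map_smul]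
        rfl)

open scoped TensorProduct

theorem units_smul_eq {M : Type*} [AddCommGroup M] [Module F M] (n : ℤ) (x : M) :
    ((-1 : ℤˣ) ^ n) • x = ((-1 : F) ^ n) • x := by
  rcases Int.even_or_odd n with h | h
  · rw [h.neg_one_zpow, h.neg_one_zpow, one_smul, one_smul]
  · rw [h.neg_one_zpow, h.neg_one_zpow, neg_smul, one_smul, Units.neg_smul, one_smul]

/-- The element `v ⊗ 1 + 1 ⊗ v`. -/
def primitive : V →ₗ[F] (degree 𝒱 ᵍ⊗[F] degree 𝒱) :=
  (GradedTensorProduct.includeLeft (degree 𝒱) (degree 𝒱)).toLinearMap ∘ₗ ι 𝒱 +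
    (GradedTensorProduct.includeRight (degree 𝒱) (degree 𝒱)).toLinearMap ∘ₗ ι 𝒱

theorem primitive_comm (i j : ℤ) (v : V) (hv : v ∈ 𝒱 i) (w : V) (hw : w ∈ 𝒱 j) :
    primitive 𝒱 v * primitive 𝒱 w = ((-1 : F) ^ (i * j)) • (primitive 𝒱 w * primitive 𝒱 v) := by
  have key : ∀ (i j : ℤ) (v : V) (_ : v ∈ 𝒱 i) (w : V) (_ : w ∈ 𝒱 j),
      primitive 𝒱 v * primitive 𝒱 w =
        GradedTensorProduct.tmul F (𝒜 := degree 𝒱) (ℬ := degree 𝒱) (ι 𝒱 v * ι 𝒱 w) 1 +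
        GradedTensorProduct.tmul F (𝒜 := degree 𝒱) (ℬ := degree 𝒱) (ι 𝒱 v) (ι 𝒱 w) +
        ((-1 : F) ^ (i * j)) •
          GradedTensorProduct.tmul F (𝒜 := degree 𝒱) (ℬ := degree 𝒱) (ι 𝒱 w) (ι 𝒱 v) +
        GradedTensorProduct.tmul F (𝒜 := degree 𝒱) (ℬ := degree 𝒱) 1 (ι 𝒱 v * ι 𝒱 w) := by
    intro i j v hv w hw
    have h1 := GradedTensorProduct.tmul_one_mul_coe_tmul (R := F) (degree 𝒱) (degree 𝒱)
      (ι 𝒱 v) ⟨ι 𝒱 w, ι_mem_degree 𝒱 hw⟩ 1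
    have h2 := GradedTensorProduct.tmul_one_mul_one_tmul (R := F) (degree 𝒱) (degree 𝒱)
      (ι 𝒱 v) (ι 𝒱 w)
    have h3 := GradedTensorProduct.tmul_coe_mul_coe_tmul (R := F) (degree 𝒱) (degree 𝒱)
      (1 : GradedSym 𝒱) ⟨ι 𝒱 v, ι_mem_degree 𝒱 hv⟩ ⟨ι 𝒱 w, ι_mem_degree 𝒱 hw⟩ 1
    have h4 := GradedTensorProduct.tmul_coe_mul_one_tmul (R := F) (degree 𝒱) (degree 𝒱)
      (1 : GradedSym 𝒱) ⟨ι 𝒱 v, ι_mem_degree 𝒱 hv⟩ (ι 𝒱 w)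
    simp only [one_mul, mul_one] at h1 h2 h3 h4
    have h3' := h3.trans (units_smul_eq (F := F) (i * j) _)
    simp only [primitive, LinearMap.add_apply, LinearMap.comp_apply, AlgHom.toLinearMap_apply,
      GradedTensorProduct.includeLeft_apply, GradedTensorProduct.includeRight_apply,
      add_mul, mul_add]
    rw [h1, h2, h3', h4]
    abel
  have hs : ((-1 : F) ^ (i * j)) * ((-1 : F) ^ (i * j)) = 1 := by
    rw [← mul_zpow]; simp
  have hl : ∀ c : F, GradedTensorProduct.tmul F (𝒜 := degree 𝒱) (ℬ := degree 𝒱)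
      (c • (ι 𝒱 w * ι 𝒱 v)) 1 = c • GradedTensorProduct.tmul F (ι 𝒱 w * ι 𝒱 v) 1 := by
    intro c; rw [GradedTensorProduct.tmul, ← TensorProduct.smul_tmul', map_smul]
  have hr : ∀ c : F, GradedTensorProduct.tmul F (𝒜 := degree 𝒱) (ℬ := degree 𝒱) 1
      (c • (ι 𝒱 w * ι 𝒱 v)) = c • GradedTensorProduct.tmul F 1 (ι 𝒱 w * ι 𝒱 v) := by
    intro c; rw [GradedTensorProduct.tmul, TensorProduct.tmul_smul, map_smul]
  rw [key i j v hv w hw, key j i w hw v hv, ι_comm 𝒱 hv hw, hl, hr, mul_comm j i]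
  simp only [smul_add, smul_smul, hs, one_smul]
  abel

/-- The comultiplication, into the graded tensor product: the algebra map with
`v ↦ v ⊗ 1 + 1 ⊗ v`, i.e. the signed unshuffle comultiplication
`v₁ ⋯ v_n ↦ ∑ ± (v_σ(1) ⋯ v_σ(i)) ⊗ (v_σ(i+1) ⋯ v_σ(n))`. -/
def comulAlgHom : GradedSym 𝒱 →ₐ[F] (degree 𝒱 ᵍ⊗[F] degree 𝒱) :=
  lift 𝒱 (primitive 𝒱) (primitive_comm 𝒱)

/-- The comultiplication of the graded symmetric coalgebra. -/
def comul : GradedSym 𝒱 →ₗ[F] GradedSym 𝒱 ⊗[F] GradedSym 𝒱 :=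
  (GradedTensorProduct.of F (degree 𝒱) (degree 𝒱)).symm.toLinearMap ∘ₗ
    (comulAlgHom 𝒱).toLinearMap


/-- The cup bracket `[a, b] = [ , ] ∘ (a ⊗ b) ∘ comul` on linear maps from the graded symmetric
coalgebra to a Lie algebra, where `q` is the degree of `b`, and
`(a ⊗ b)(x ⊗ y) = (-1)^(q|x|) a(x) ⊗ b(y)`. -/
def cupBracket {g : Type*} [AddCommGroup g] [Module F g] (bracket : g →ₗ[F] g →ₗ[F] g) (q : ℤ)
    (a b : GradedSym 𝒱 →ₗ[F] g) : GradedSym 𝒱 →ₗ[F] g :=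
  TensorProduct.lift bracket ∘ₗ
    TensorProduct.map (a ∘ₗ koszulSign (degree 𝒱) q) b ∘ₗ comul 𝒱

end GradedSym

end GradedSym

/-! ## Differential Batalin-Vilkovisky algebras -/

section BV

set_option linter.unusedSectionVars false

variable {F A : Type*} [Field F] [NonUnitalRing A] [Module F A] [IsScalarTower F A A]
  [SMulCommClass F A A]

/-- A Gerstenhaber algebra structure on a graded algebra `A = ⨁ 𝒜 n` (a unit is not required):
a graded commutative product and a graded Lie bracket of degree `-1`, for which bracketing with
`a` is a derivation of the bracket of degree `|a| - 1` (the Jacobi identity). The Leibniz rule for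
the bracket with respect to the product is not required. -/
structure GerstenhaberAlgebra (𝒜 : ℤ → Submodule F A) where
  mul_mem : ∀ i j, ∀ a ∈ 𝒜 i, ∀ b ∈ 𝒜 j, a * b ∈ 𝒜 (i + j)
  mul_comm : ∀ i j, ∀ a ∈ 𝒜 i, ∀ b ∈ 𝒜 j, a * b = ((-1 : F) ^ (i * j)) • (b * a)
  /-- The bracket. -/
  bracket : A →ₗ[F] A →ₗ[F] A
  bracket_mem : ∀ i j, ∀ a ∈ 𝒜 i, ∀ b ∈ 𝒜 j, bracket a b ∈ 𝒜 (i + j - 1)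
  bracket_skew : ∀ i j, ∀ a ∈ 𝒜 i, ∀ b ∈ 𝒜 j,
    bracket a b = -(((-1 : F) ^ ((i - 1) * (j - 1))) • bracket b a)
  bracket_jacobi : ∀ i j, ∀ a ∈ 𝒜 i, ∀ b ∈ 𝒜 j, ∀ c,
    bracket a (bracket b c) =
      bracket (bracket a b) c + ((-1 : F) ^ ((i - 1) * (j - 1))) • bracket b (bracket a c)

/-- A Batalin-Vilkovisky algebra: a Gerstenhaber algebra with a generator `Δ` of square zero. -/
structure BVAlgebra (𝒜 : ℤ → Submodule F A) extends GerstenhaberAlgebra 𝒜 where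
  /-- The generator of the bracket. -/
  Δ : A →ₗ[F] A
  Δ_mem : ∀ i, ∀ a ∈ 𝒜 i, Δ a ∈ 𝒜 (i - 1)
  bracket_eq : ∀ i, ∀ a ∈ 𝒜 i, ∀ b,
    bracket a b = ((-1 : F) ^ i) • (Δ (a * b) - Δ a * b - ((-1 : F) ^ i) • (a * Δ b))
  Δ_Δ : Δ ∘ₗ Δ = 0

/-- A differential Batalin-Vilkovisky algebra. -/
structure DifferentialBVAlgebra (𝒜 : ℤ → Submodule F A) extends BVAlgebra 𝒜 where
  /-- The differential. -/
  d : A →ₗ[F] A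
  d_mem : ∀ i, ∀ a ∈ 𝒜 i, d a ∈ 𝒜 (i + 1)
  d_d : d ∘ₗ d = 0
  d_mul : ∀ i, ∀ a ∈ 𝒜 i, ∀ b, d (a * b) = d a * b + ((-1 : F) ^ i) • (a * d b)
  Δ_d : Δ ∘ₗ d + d ∘ₗ Δ = 0

/-- The Lie algebra grading `g_j = A^{1-j}`, for which the bracket has degree `0` and `d` has
degree `-1`. -/
def lieGrading (𝒜 : ℤ → Submodule F A) : ℤ → Submodule F A := regrade (Equiv.subLeft 1) 𝒜

instance lieGradingDecomposition (𝒜 : ℤ → Submodule F A) [Decomposition 𝒜] :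
    Decomposition (lieGrading 𝒜) := regradeDecomposition _ 𝒜

theorem mem_lieGrading (𝒜 : ℤ → Submodule F A) (j : ℤ) (x : A) :
    x ∈ lieGrading 𝒜 j ↔ x ∈ 𝒜 (1 - j) := Iff.rfl

namespace DifferentialBVAlgebra

variable {𝒜 : ℤ → Submodule F A} (B : DifferentialBVAlgebra 𝒜)

theorem Δ_d_apply (x : A) : B.Δ (B.d x) = -B.d (B.Δ x) :=
  eq_neg_of_add_eq_zero_left (LinearMap.congr_fun B.Δ_d x)

/-- The homology `H(g) = H(g, d)`. -/
abbrev H : Type _ := Homology B.d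

/-- The grading of `H(g)` induced by `g_j = A^{1-j}`. -/
def HGrading : ℤ → Submodule F B.H := homologyGrading (lieGrading 𝒜) B.d

instance HGradingDecomposition [Decomposition 𝒜] : Decomposition B.HGrading :=
  homologyDecomposition (lieGrading 𝒜) B.d (-1) (by
    intro n x hx
    rw [mem_lieGrading] at hx ⊢
    convert B.d_mem _ x hx using 2
    ring)

/-- The differential `d` is a derivation of the bracket. -/
theorem d_bracket [Decomposition 𝒜] (i : ℤ) (a : A) (ha : a ∈ 𝒜 i) (b : A) :
    B.d (B.bracket a b) = B.bracket (B.d a) b - ((-1 : F) ^ i) • B.bracket a (B.d b) := by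
  have hne : (-1 : F) ≠ 0 := by simp
  have hs : ((-1 : F) ^ i) * ((-1 : F) ^ i) = 1 := by rw [← mul_zpow]; simp
  have h1 : B.d (B.Δ (a * b)) = -B.Δ (B.d (a * b)) := by rw [B.Δ_d_apply, neg_neg]
  rw [B.bracket_eq i a ha b, B.bracket_eq (i + 1) (B.d a) (B.d_mem i a ha) b,
    B.bracket_eq i a ha (B.d b), zpow_add_one₀ hne, map_smul, map_sub, map_sub, map_smul, h1,
    B.d_mul i a ha b, B.d_mul (i - 1) (B.Δ a) (B.Δ_mem i a ha) b, B.d_mul i a ha (B.Δ b),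
    zpow_sub_one₀ hne, B.Δ_d_apply a, B.Δ_d_apply b, map_add, map_smul]
  simp only [smul_sub, smul_add, smul_neg, neg_mul, mul_neg, smul_smul, hs, neg_smul, mul_one,
    inv_neg, inv_one, one_smul, neg_neg]
  abel

theorem d_bracket' [Decomposition 𝒜] (a b : A) :
    B.d (B.bracket a b) = B.bracket (B.d a) b - B.bracket (koszulSign 𝒜 1 a) (B.d b) := by
  induction a using Decomposition.inductionOn 𝒜 with
  | zero => simp
  | add x y hx hy =>
    simp only [map_add, LinearMap.add_apply, hx, hy]
    abel
  | @homogeneous i a =>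
    rw [koszulSign_of_mem 𝒜 1 a.2, one_mul, map_smul, LinearMap.smul_apply,
      B.d_bracket i a a.2]

theorem koszulSign_d [Decomposition 𝒜] (a : A) :
    B.d (koszulSign 𝒜 1 a) = -koszulSign 𝒜 1 (B.d a) := by
  induction a using Decomposition.inductionOn 𝒜 with
  | zero => simp
  | add x y hx hy =>
    simp only [map_add, hx, hy]
    abel
  | @homogeneous i a =>
    rw [koszulSign_of_mem 𝒜 1 a.2, koszulSign_of_mem 𝒜 1 (B.d_mem i a a.2), map_smul, one_mul,
      one_mul, zpow_add_one₀ (by simp)]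
    simp

theorem koszulSign_koszulSign [Decomposition 𝒜] (a : A) :
    koszulSign 𝒜 1 (koszulSign 𝒜 1 a) = a := by
  induction a using Decomposition.inductionOn 𝒜 with
  | zero => simp
  | add x y hx hy => simp only [map_add, hx, hy]
  | @homogeneous i a =>
    rw [koszulSign_of_mem 𝒜 1 a.2, map_smul, koszulSign_of_mem 𝒜 1 a.2, smul_smul, ← mul_zpow]
    simp

/-- The bracket of two cycles, as a cycle. -/
def cycleBracket [Decomposition 𝒜] :
    LinearMap.ker B.d →ₗ[F] LinearMap.ker B.d →ₗ[F] LinearMap.ker B.d :=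
  LinearMap.mk₂ F
    (fun x y => ⟨B.bracket x y, by
      rw [LinearMap.mem_ker, B.d_bracket', LinearMap.mem_ker.1 x.2, LinearMap.mem_ker.1 y.2]
      simp⟩)
    (fun x x' y => Subtype.ext (by simp))
    (fun c x y => Subtype.ext (by simp))
    (fun x y y' => Subtype.ext (by simp))
    (fun c x y => Subtype.ext (by simp))

/-- The bracket induced on `H(g)`: `[[x], [y]] = [[x, y]]` for cycles `x`, `y`. -/
def homologyBracket [Decomposition 𝒜] : B.H →ₗ[F] B.H →ₗ[F] B.H :=
  Submodule.liftQ _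
    (LinearMap.mk₂ F
      (fun x => Submodule.liftQ _ (homologyClass B.d ∘ₗ B.cycleBracket x) (by
        rintro ⟨_, hy⟩ ⟨v, rfl⟩
        refine (Submodule.Quotient.mk_eq_zero _).2 ⟨-B.bracket (koszulSign 𝒜 1 x) v, ?_⟩
        change _ = B.bracket x (B.d v)
        simp [B.d_bracket', B.koszulSign_d, LinearMap.mem_ker.1 x.2, koszulSign_koszulSign]))
      (fun x x' y => by
        obtain ⟨y, rfl⟩ := Submodule.mkQ_surjective _ y
        simp)
      (fun c x y => by
        obtain ⟨y, rfl⟩ := Submodule.mkQ_surjective _ y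
        simp)
      (fun x y y' => by simp)
      (fun c x y => by simp))
    (by
      rintro ⟨_, hx⟩ ⟨u, rfl⟩
      refine LinearMap.ext fun y => ?_
      obtain ⟨y, rfl⟩ := Submodule.mkQ_surjective _ y
      refine (Submodule.Quotient.mk_eq_zero _).2 ⟨B.bracket u y, ?_⟩
      change _ = B.bracket (B.d u) y
      simp [B.d_bracket', LinearMap.mem_ker.1 y.2])

theorem homologyBracket_class [Decomposition 𝒜] (x y : LinearMap.ker B.d) :
    B.homologyBracket (homologyClass B.d x) (homologyClass B.d y) =
      homologyClass B.d (B.cycleBracket x y) := rfl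

/-- The subcomplex `m = Ker Δ`. -/
abbrev m : Submodule F A := LinearMap.ker B.Δ

/-- The differential of `m = Ker Δ`. -/
def dm : B.m →ₗ[F] B.m :=
  B.d.restrict fun x hx => by
    rw [LinearMap.mem_ker, B.Δ_d_apply, LinearMap.mem_ker.1 hx, map_zero, neg_zero]

/-- The grading of `m = Ker Δ` induced by `g_j = A^{1-j}`. -/
def mGrading (n : ℤ) : Submodule F B.m := (lieGrading 𝒜 n).submoduleOf B.m

/-- The map `H(Ker Δ, d) → H(g, d)` induced by the inclusion. -/
def inclHomology : Homology B.dm →ₗ[F] B.H := homologyMap B.dm B.d B.m.subtype rfl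

/-- The statement of the Kählerian formality (`∂∂̄`) lemma: the inclusion `(Ker Δ, d) → (g, d)`
and the projection `(Ker Δ, d) → (H(g, Δ), 0)`, which in particular is a chain map, are
isomorphisms on homology. -/
structure KahlerFormality : Prop where
  incl_bijective : Function.Bijective B.inclHomology
  proj_chain : homologyClass B.Δ ∘ₗ B.dm = 0
  proj_bijective : Function.Bijective (homologyDesc B.dm (homologyClass B.Δ) proj_chain)

/-- The projection `Ker Δ → H(g, Δ)`, followed by the isomorphisms
`H(g, Δ) ≅ H(Ker Δ, d) ≅ H(g, d)` of the formality statement. -/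
def proj {B : DifferentialBVAlgebra 𝒜} (hB : B.KahlerFormality) : B.m →ₗ[F] B.H :=
  (LinearEquiv.ofBijective _ hB.incl_bijective).toLinearMap ∘ₗ
    (LinearEquiv.ofBijective _ hB.proj_bijective).symm.toLinearMap ∘ₗ homologyClass B.Δ

/-- The universal twisting cochain `S^c[sH(g)] → H(g)` of the abelian graded Lie algebra `H(g)`:
`sx ↦ x`, and zero on `S^c_k[sH(g)]` for `k ≠ 1`. -/
def universalTwistingCochain : GradedSym (suspend B.HGrading) →ₗ[F] B.H :=
  GradedSym.proj₁ (suspend B.HGrading)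

end DifferentialBVAlgebra

end BV

end

/-! On Ker Δ the two correction terms of the BV formula vanish, so [x, y] = Δ(±xy) (`bracket_eq_Δ`).
Thus m = Ker Δ is a differential graded Lie subalgebra whose brackets lie in Im Δ, and Im Δ is
exactly the kernel of `proj` (`proj_eq_zero_iff`). Hence π kills all brackets of m, and the bracket
on H(g) vanishes because both quasi-isomorphisms start at m.

The twisting cochain is built inside m, as a solution T of T = ∇τ_H - hQ with Q = ½[T, T]. As T(1) =
0, the value of [T, T] on a word depends only on T on shorter words, so the recursion can be solved
(`exists_recursive_solution`). Since πQ = 0, the homotopy relation reads dhQ + hdQ = -Q, whence dT =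
Q + hdQ. The derivation property and the Jacobi identity give dQ = [dT, T] and [Q, T] = 0, so the
defect Φ = dT - Q satisfies Φ = h[Φ, T] and vanishes by induction on word length
(`exists_master_equation_solution`).

The three claims follow: T has values in Ker Δ by construction; πT = τ_H because π∇ = id and πh = 0;
and on words of length k ≥ 2 this says πT = 0, so that T lands in Ker π = Im Δ. -/

open TensorProduct

/-! ### Words, word length and homogeneous maps on the symmetric coalgebra. -/

namespace GradedSym

variable {F V : Type*} [Field F] [AddCommGroup V] [Module F V] (𝒱 : ℤ → Submodule F V)

/-- Words are generated from the empty word by multiplication with homogeneous letters. -/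
theorem word_induction [Decomposition 𝒱] {P : GradedSym 𝒱 → Prop} (one : P 1)
    (add : ∀ x y, P x → P y → P (x + y)) (smul : ∀ (c : F) x, P x → P (c • x))
    (ι_mul : ∀ i, ∀ v ∈ 𝒱 i, ∀ x, P x → P (ι 𝒱 v * x)) (x : GradedSym 𝒱) : P x := by
  have zero : P 0 := by simpa using smul 0 1 one
  have hx : x ∈ ⨆ n, degree 𝒱 n := by
    rw [(Decomposition.isInternal (degree 𝒱)).submodule_iSup_eq_top]
    trivial
  induction hx using Submodule.iSup_induction' with
  | zero => exact zero
  | add x y _ _ hx hy => exact add x y hx hy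
  | mem n x hx =>
    induction hx using Submodule.span_induction with
    | zero => exact zero
    | add x y _ _ hx hy => exact add x y hx hy
    | smul c x _ hx => exact smul c x hx
    | mem x hx =>
      obtain ⟨l, -, rfl⟩ := hx
      induction l with
      | nil => exact one
      | cons p l ih =>
        rw [List.map_cons, List.prod_cons]
        exact ι_mul _ _ p.2.2 _ ih

/-- Spanning suffices, without directness of the sum: maps are compared, and limits taken, one word
length at a time. -/
theorem iSup_power [Decomposition 𝒱] : ⨆ k, power 𝒱 k = ⊤ := by
  refine (Submodule.eq_top_iff').2 ?_
  refine word_induction 𝒱 ?_ (fun x y => add_mem) (fun c x => Submodule.smul_mem _ c) ?_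
  · exact Submodule.mem_iSup_of_mem 0 (by rw [power, pow_zero]; exact Submodule.one_le.1 le_rfl)
  · intro i v _ x hx
    induction hx using Submodule.iSup_induction' with
    | zero => rw [mul_zero]; exact zero_mem _
    | add x y _ _ hx hy => rw [mul_add]; exact add_mem hx hy
    | mem k x hx =>
      refine Submodule.mem_iSup_of_mem (k + 1) ?_
      rw [power, pow_succ']
      exact Submodule.mul_mem_mul ⟨v, rfl⟩ hx

theorem linearMap_ext [Decomposition 𝒱] {W : Type*} [AddCommGroup W] [Module F W]
    {f g : GradedSym 𝒱 →ₗ[F] W} (h : ∀ k, ∀ x ∈ power 𝒱 k, f x = g x) : f = g := by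
  refine LinearMap.ext fun x => ?_
  have hx : x ∈ ⨆ k, power 𝒱 k := by rw [iSup_power]; trivial
  induction hx using Submodule.iSup_induction' with
  | zero => simp
  | add x y _ _ hx hy => rw [map_add, map_add, hx, hy]
  | mem k x hx => exact h k x hx

/-- Left multiplication by a letter, precomposed to a map. -/
def precompLetter {W : Type*} [AddCommGroup W] [Module F W] (v : V) :
    (GradedSym 𝒱 →ₗ[F] W) →ₗ[F] (GradedSym 𝒱 →ₗ[F] W) :=
  (LinearMap.mulLeft F (ι 𝒱 v)).lcomp F W

theorem precompLetter_apply {W : Type*} [AddCommGroup W] [Module F W] (v : V)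
    (f : GradedSym 𝒱 →ₗ[F] W) (x : GradedSym 𝒱) :
    precompLetter 𝒱 v f x = f (ι 𝒱 v * x) := rfl

/-- `f` is homogeneous of degree `p` for the total degree. -/
def IsHomogeneousMap {W : Type*} [AddCommGroup W] [Module F W] (𝒲 : ℤ → Submodule F W) (p : ℤ)
    (f : GradedSym 𝒱 →ₗ[F] W) : Prop :=
  ∀ n, ∀ x ∈ degree 𝒱 n, f x ∈ 𝒲 (n + p)

variable {𝒱} in
theorem IsHomogeneousMap.apply_one
    {W : Type*} [AddCommGroup W] [Module F W]
    {𝒢 : ℤ → Submodule F W} {p : ℤ} {a : GradedSym 𝒱 →ₗ[F] W} (ha : IsHomogeneousMap 𝒱 𝒢 p a) :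
    a 1 ∈ 𝒢 p := by
  simpa using ha 0 1 (SetLike.GradedOne.one_mem (A := degree 𝒱))

variable {𝒱} in
theorem IsHomogeneousMap.precompLetter
    {W : Type*} [AddCommGroup W] [Module F W]
    {𝒢 : ℤ → Submodule F W} {p : ℤ} {a : GradedSym 𝒱 →ₗ[F] W} (ha : IsHomogeneousMap 𝒱 𝒢 p a)
    {i : ℤ} {v : V} (hv : v ∈ 𝒱 i) : IsHomogeneousMap 𝒱 𝒢 (p + i) (precompLetter 𝒱 v a) := by
  intro n x hx
  have := ha (i + n) _ (SetLike.GradedMul.mul_mem (ι_mem_degree 𝒱 hv) hx)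
  rwa [show n + (p + i) = i + n + p by ring]

variable {𝒱} in
theorem eq_zero_of_mem_power_zero {W : Type*} [AddCommGroup W] [Module F W]
    {a : GradedSym 𝒱 →ₗ[F] W} (h : a 1 = 0) (x : GradedSym 𝒱) (hx : x ∈ power 𝒱 0) :
    a x = 0 := by
  rw [power, pow_zero, Submodule.mem_one] at hx
  obtain ⟨c, rfl⟩ := hx
  rw [Algebra.algebraMap_eq_smul_one, map_smul, h, smul_zero]

/-! ### The cup bracket and its graded Lie identities. -/

variable [Decomposition 𝒱] {g : Type*} [AddCommGroup g] [Module F g]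
  (β : g →ₗ[F] g →ₗ[F] g)

theorem cupBracket_one (q : ℤ) (a b : GradedSym 𝒱 →ₗ[F] g) :
    cupBracket 𝒱 β q a b 1 = β (a 1) (b 1) := by
  have h1 : comul 𝒱 1 = 1 ⊗ₜ 1 := by
    rw [comul, LinearMap.comp_apply, AlgHom.toLinearMap_apply, map_one]
    rfl
  rw [cupBracket, LinearMap.comp_apply, LinearMap.comp_apply, h1]
  simp [koszulSign_of_mem (degree 𝒱) q (SetLike.GradedOne.one_mem (A := degree 𝒱))]

theorem comul_ι_mul (v : V) (x : GradedSym 𝒱) :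
    comul 𝒱 (ι 𝒱 v * x) = (GradedTensorProduct.of F (degree 𝒱) (degree 𝒱)).symm
      (primitive 𝒱 v * GradedTensorProduct.of F (degree 𝒱) (degree 𝒱) (comul 𝒱 x)) := by
  simp [comul, comulAlgHom, lift_ι]

theorem primitive_mul_tmul {i j : ℤ} {v : V} (hv : v ∈ 𝒱 i) {x : GradedSym 𝒱}
    (hx : x ∈ degree 𝒱 j) (y : GradedSym 𝒱) :
    (GradedTensorProduct.of F (degree 𝒱) (degree 𝒱)).symm
      (primitive 𝒱 v * GradedTensorProduct.of F (degree 𝒱) (degree 𝒱) (x ⊗ₜ y)) =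
      (ι 𝒱 v * x) ⊗ₜ y + ((-1 : F) ^ (i * j)) • (x ⊗ₜ (ι 𝒱 v * y)) := by
  have h1 := GradedTensorProduct.tmul_one_mul_coe_tmul (R := F) (degree 𝒱) (degree 𝒱)
    (ι 𝒱 v) ⟨x, hx⟩ y
  have h2 := (GradedTensorProduct.tmul_coe_mul_coe_tmul (R := F) (degree 𝒱) (degree 𝒱)
    (1 : GradedSym 𝒱) ⟨ι 𝒱 v, ι_mem_degree 𝒱 hv⟩ ⟨x, hx⟩ y).trans
      (units_smul_eq (F := F) (i * j) _)
  rw [one_mul] at h2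
  change (GradedTensorProduct.of F (degree 𝒱) (degree 𝒱)).symm
    (primitive 𝒱 v * GradedTensorProduct.tmul F x y) = _
  simp only [primitive, LinearMap.add_apply, LinearMap.comp_apply, AlgHom.toLinearMap_apply,
    GradedTensorProduct.includeLeft_apply, GradedTensorProduct.includeRight_apply, add_mul]
  rw [h1, h2, map_add, map_smul]
  rfl

/-- A Leibniz rule: the letter `v` is absorbed by `a` or by `b`. If |x| = j, passing `v` over `x`
costs (-1)^(ij), which merges with (-1)^(qj) into the Koszul sign for a second map of degree q + i.
Together with `cupBracket_one` it reduces identities of the cup bracket to identities of `β`, by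
induction on words, with no appeal to coassociativity or cocommutativity. -/
theorem cupBracket_ι_mul (q : ℤ) (a b : GradedSym 𝒱 →ₗ[F] g) {i : ℤ} {v : V} (hv : v ∈ 𝒱 i)
    (x : GradedSym 𝒱) :
    cupBracket 𝒱 β q a b (ι 𝒱 v * x) =
      ((-1 : F) ^ (q * i)) • cupBracket 𝒱 β q (precompLetter 𝒱 v a) b x +
        cupBracket 𝒱 β (q + i) a (precompLetter 𝒱 v b) x := by
  have hne : (-1 : F) ≠ 0 := by simp
  simp only [cupBracket, LinearMap.comp_apply, comul_ι_mul]
  induction comul 𝒱 x using TensorProduct.induction_on with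
  | zero => simp
  | add s t hs ht =>
    simp only [map_add, mul_add, smul_add, hs, ht]
    abel
  | tmul x y =>
    induction x using Decomposition.inductionOn (degree 𝒱) with
    | zero => simp
    | add s t hs ht =>
      simp only [TensorProduct.add_tmul, map_add, mul_add, smul_add, hs, ht]
      abel
    | @homogeneous j x =>
      rw [primitive_mul_tmul 𝒱 hv x.2]
      simp only [map_add, map_smul, TensorProduct.map_tmul, TensorProduct.lift.tmul,
        LinearMap.comp_apply, precompLetter_apply, koszulSign_of_mem (degree 𝒱) _ x.2,
        koszulSign_of_mem (degree 𝒱) q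
          (SetLike.GradedMul.mul_mem (ι_mem_degree 𝒱 hv) x.2), LinearMap.smul_apply, smul_smul]
      rw [← zpow_add₀ hne, ← zpow_add₀ hne]
      ring_nf

theorem cupBracket_add_left (q : ℤ) (a a' b : GradedSym 𝒱 →ₗ[F] g) :
    cupBracket 𝒱 β q (a + a') b = cupBracket 𝒱 β q a b + cupBracket 𝒱 β q a' b := by
  simp only [cupBracket, LinearMap.add_comp, TensorProduct.map_add_left, LinearMap.comp_add]

theorem cupBracket_add_right (q : ℤ) (a b b' : GradedSym 𝒱 →ₗ[F] g) :
    cupBracket 𝒱 β q a (b + b') = cupBracket 𝒱 β q a b + cupBracket 𝒱 β q a b' := by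
  simp only [cupBracket, LinearMap.add_comp, TensorProduct.map_add_right, LinearMap.comp_add]

theorem cupBracket_smul_left (q : ℤ) (c : F) (a b : GradedSym 𝒱 →ₗ[F] g) :
    cupBracket 𝒱 β q (c • a) b = c • cupBracket 𝒱 β q a b := by
  simp only [cupBracket, LinearMap.smul_comp, TensorProduct.map_smul_left, LinearMap.comp_smul]

theorem cupBracket_smul_right (q : ℤ) (c : F) (a b : GradedSym 𝒱 →ₗ[F] g) :
    cupBracket 𝒱 β q a (c • b) = c • cupBracket 𝒱 β q a b := by
  simp only [cupBracket, LinearMap.smul_comp, TensorProduct.map_smul_right, LinearMap.comp_smul]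

/-- Each term on the right contains the factor `a - b`, so the squares of two maps that agree on
short words can be compared. -/
theorem cupBracket_mul_self (q : ℤ) (a b : GradedSym 𝒱 →ₗ[F] g) :
    cupBracket 𝒱 β q a a - cupBracket 𝒱 β q b b =
      cupBracket 𝒱 β q (a - b) a + cupBracket 𝒱 β q b (a - b) := by
  have h1 := cupBracket_add_left 𝒱 β q (a - b) b a
  have h2 := cupBracket_add_right 𝒱 β q b (a - b) b
  rw [sub_add_cancel] at h1 h2
  rw [h1, h2]
  abel

/-- The cup bracket vanishes on words of length `n` if it does so for each splitting. -/
theorem cupBracket_eq_zero_of_power (n : ℕ) (q : ℤ) (a b : GradedSym 𝒱 →ₗ[F] g)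
    (h : ∀ i j, i + j = n → (∀ x ∈ power 𝒱 i, a x = 0) ∨ (∀ x ∈ power 𝒱 j, b x = 0))
    (x : GradedSym 𝒱) (hx : x ∈ power 𝒱 n) : cupBracket 𝒱 β q a b x = 0 := by
  have one_mem : (1 : GradedSym 𝒱) ∈ power 𝒱 0 := by
    rw [power, pow_zero]; exact Submodule.one_le.1 le_rfl
  have cons_mem : ∀ {k : ℕ} (v : V) {y : GradedSym 𝒱}, y ∈ power 𝒱 k →
      ι 𝒱 v * y ∈ power 𝒱 (k + 1) := by
    intro k v y hy
    rw [power, pow_succ']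
    exact Submodule.mul_mem_mul ⟨v, rfl⟩ hy
  induction n generalizing q a b x with
  | zero =>
    rw [power, pow_zero, Submodule.mem_one] at hx
    obtain ⟨c, rfl⟩ := hx
    rw [Algebra.algebraMap_eq_smul_one, map_smul, cupBracket_one]
    rcases h 0 0 rfl with h | h <;> simp [h 1 one_mem]
  | succ n ih =>
    rw [power, pow_succ'] at hx
    refine Submodule.mul_induction_on hx ?_ fun s t hs ht => by rw [map_add, hs, ht, add_zero]
    rintro _ ⟨v, rfl⟩ y hy
    induction v using Decomposition.inductionOn 𝒱 with
    | zero => simp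
    | add s t hs ht => rw [map_add, add_mul, map_add, hs, ht, add_zero]
    | @homogeneous i v =>
      -- Whichever factor absorbs the letter, its vanishing hypothesis is used one length higher.
      rw [cupBracket_ι_mul 𝒱 β q a b v.2, ih, ih, smul_zero, add_zero]
      · intro i j hij
        exact (h i (j + 1) (by omega)).imp_right fun H z hz => H _ (cons_mem _ hz)
      · exact hy
      · intro i j hij
        exact (h (i + 1) j (by omega)).imp_left fun H z hz => H _ (cons_mem _ hz)
      · exact hy

variable {𝒱 β} {𝒢 : ℤ → Submodule F g} {p q r : ℤ} {a b c : GradedSym 𝒱 →ₗ[F] g}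

theorem IsHomogeneousMap.cupBracket (hβ : ∀ i j, ∀ x ∈ 𝒢 i, ∀ y ∈ 𝒢 j, β x y ∈ 𝒢 (i + j))
    (ha : IsHomogeneousMap 𝒱 𝒢 p a) (hb : IsHomogeneousMap 𝒱 𝒢 q b) :
    IsHomogeneousMap 𝒱 𝒢 (p + q) (cupBracket 𝒱 β q a b) := by
  intro n x hx
  induction hx using Submodule.span_induction with
  | zero => rw [map_zero]; exact zero_mem _
  | add x y _ _ hx hy => rw [map_add]; exact add_mem hx hy
  | smul c x _ hx => rw [map_smul]; exact Submodule.smul_mem _ c hx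
  | mem x hx =>
    obtain ⟨l, rfl, rfl⟩ := hx
    induction l generalizing p q a b with
    | nil => simpa [cupBracket_one] using hβ p q _ ha.apply_one _ hb.apply_one
    | cons w l ih =>
      simp only [List.map_cons, List.prod_cons, List.sum_cons]
      rw [cupBracket_ι_mul 𝒱 β q a b w.2.2]
      refine add_mem (Submodule.smul_mem _ _ ?_) ?_
      · convert ih (ha.precompLetter w.2.2) hb using 2
        ring
      · convert ih ha (hb.precompLetter w.2.2) using 2
        ring

theorem neg_one_zpow_mul_self (n : ℤ) : ((-1 : F) ^ n) * ((-1 : F) ^ n) = 1 := by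
  rw [← mul_zpow]; simp

theorem cupBracket_skew
    (skew : ∀ i j, ∀ x ∈ 𝒢 i, ∀ y ∈ 𝒢 j, β x y = -(((-1 : F) ^ (i * j)) • β y x))
    (ha : IsHomogeneousMap 𝒱 𝒢 p a) (hb : IsHomogeneousMap 𝒱 𝒢 q b) :
    cupBracket 𝒱 β q a b = -(((-1 : F) ^ (p * q)) • cupBracket 𝒱 β p b a) := by
  refine LinearMap.ext fun x => ?_
  -- Maps and degrees must vary in the induction: absorbing a letter of degree i replaces a map of
  -- degree p by one of degree p + i.
  revert p q a b
  refine word_induction 𝒱 (P := fun x => ∀ {p q : ℤ} {a b : GradedSym 𝒱 →ₗ[F] g},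
    IsHomogeneousMap 𝒱 𝒢 p a → IsHomogeneousMap 𝒱 𝒢 q b → GradedSym.cupBracket 𝒱 β q a b x =
      (-(((-1 : F) ^ (p * q)) • GradedSym.cupBracket 𝒱 β p b a)) x) ?_ ?_ ?_ ?_ x
  · intro p q a b ha hb
    simpa [cupBracket_one] using skew p q _ ha.apply_one _ hb.apply_one
  · intro x y hx hy p q a b ha hb
    rw [map_add, map_add, hx ha hb, hy ha hb]
  · intro c x hx p q a b ha hb
    rw [map_smul, map_smul, hx ha hb]
  · intro i v hv x hx p q a b ha hb
    have hs := neg_one_zpow_mul_self (F := F) (q * i)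
    rw [cupBracket_ι_mul 𝒱 β q a b hv, LinearMap.neg_apply, LinearMap.smul_apply,
      cupBracket_ι_mul 𝒱 β p b a hv, hx (ha.precompLetter hv) hb, hx ha (hb.precompLetter hv)]
    simp only [LinearMap.neg_apply, LinearMap.smul_apply, smul_neg, smul_add, smul_smul, add_mul,
      mul_add, zpow_add₀ (show (-1 : F) ≠ 0 by simp), mul_comm i q]
    rw [mul_left_comm, hs, mul_one]
    abel

theorem cupBracket_jacobi
    (jacobi : ∀ i j, ∀ x ∈ 𝒢 i, ∀ y ∈ 𝒢 j, ∀ z,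
      β x (β y z) = β (β x y) z + ((-1 : F) ^ (i * j)) • β y (β x z))
    (ha : IsHomogeneousMap 𝒱 𝒢 p a) (hb : IsHomogeneousMap 𝒱 𝒢 q b)
    (hc : IsHomogeneousMap 𝒱 𝒢 r c) :
    cupBracket 𝒱 β (q + r) a (cupBracket 𝒱 β r b c) =
      cupBracket 𝒱 β r (cupBracket 𝒱 β q a b) c +
        ((-1 : F) ^ (p * q)) • cupBracket 𝒱 β (p + r) b (cupBracket 𝒱 β r a c) := by
  -- The Leibniz rule as an equality of maps, for use inside an inner cup bracket.
  have letter : ∀ (q : ℤ) (a b : GradedSym 𝒱 →ₗ[F] g) {i : ℤ} {v : V}, v ∈ 𝒱 i →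
      GradedSym.precompLetter 𝒱 v (GradedSym.cupBracket 𝒱 β q a b) =
      ((-1 : F) ^ (q * i)) • GradedSym.cupBracket 𝒱 β q (GradedSym.precompLetter 𝒱 v a) b +
        GradedSym.cupBracket 𝒱 β (q + i) a (GradedSym.precompLetter 𝒱 v b) :=
    fun q a b i v hv => LinearMap.ext fun x => cupBracket_ι_mul 𝒱 β q a b hv x
  refine LinearMap.ext fun x => ?_
  revert p q r a b c
  refine word_induction 𝒱 (P := fun x => ∀ {p q r : ℤ} {a b c : GradedSym 𝒱 →ₗ[F] g},
    IsHomogeneousMap 𝒱 𝒢 p a → IsHomogeneousMap 𝒱 𝒢 q b → IsHomogeneousMap 𝒱 𝒢 r c →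
    GradedSym.cupBracket 𝒱 β (q + r) a (GradedSym.cupBracket 𝒱 β r b c) x =
      (GradedSym.cupBracket 𝒱 β r (GradedSym.cupBracket 𝒱 β q a b) c +
        ((-1 : F) ^ (p * q)) •
          GradedSym.cupBracket 𝒱 β (p + r) b (GradedSym.cupBracket 𝒱 β r a c)) x) ?_ ?_ ?_ ?_ x
  · intro p q r a b c ha hb hc
    simpa [cupBracket_one] using jacobi p q _ ha.apply_one _ hb.apply_one (c 1)
  · intro x y hx hy p q r a b c ha hb hc
    rw [map_add, map_add, hx ha hb hc, hy ha hb hc]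
  · intro k x hx p q r a b c ha hb hc
    rw [map_smul, map_smul, hx ha hb hc]
  · intro i v hv x hx p q r a b c ha hb hc
    have e1 : q + r + i = q + (r + i) := by ring
    have e2 : q + r + i = q + i + r := by ring
    have e3 : p + r + i = p + (r + i) := by ring
    have e4 : p + r + i = p + i + r := by ring
    have h1 := hx (ha.precompLetter hv) hb hc
    have h2 := hx ha (hb.precompLetter hv) hc
    have h3 := hx ha hb (hc.precompLetter hv)
    rw [← e1, ← e3] at h3
    rw [← e2] at h2
    rw [← e4] at h1
    simp only [LinearMap.add_apply, LinearMap.smul_apply] at h1 h2 h3 ⊢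
    rw [cupBracket_ι_mul 𝒱 β _ _ _ hv, cupBracket_ι_mul 𝒱 β _ _ _ hv,
      cupBracket_ι_mul 𝒱 β _ _ _ hv, letter _ _ _ hv, letter _ _ _ hv, letter _ _ _ hv]
    simp only [cupBracket_add_left, cupBracket_add_right, cupBracket_smul_left,
      cupBracket_smul_right, LinearMap.add_apply, LinearMap.smul_apply]
    rw [h1, h2, h3]
    have s1 := neg_one_zpow_mul_self (F := F) (q * i)
    simp only [smul_add, smul_smul, add_mul, mul_add, mul_comm i,
      zpow_add₀ (show (-1 : F) ≠ 0 by simp)]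
    -- Only the coefficient of [b, [a_v, c]], where a_v is `a` after absorbing the letter, contains
    -- a square of (-1)^(qi) that has to be cancelled.
    match_scalars <;> first
      | ring1
      | linear_combination ((-1 : F) ^ (r * i) * (-1 : F) ^ (p * q)) * s1

/-- A derivation of degree `-1` of the bracket is one of the cup bracket. -/
theorem cupBracket_derivation {d : g →ₗ[F] g}
    (hd : ∀ i, ∀ x ∈ 𝒢 i, ∀ y, d (β x y) = β (d x) y + ((-1 : F) ^ i) • β x (d y))
    (ha : IsHomogeneousMap 𝒱 𝒢 p a) :
    d ∘ₗ cupBracket 𝒱 β q a b =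
      cupBracket 𝒱 β q (d ∘ₗ a) b + ((-1 : F) ^ p) • cupBracket 𝒱 β (q - 1) a (d ∘ₗ b) := by
  refine LinearMap.ext fun x => ?_
  revert p q a b
  refine word_induction 𝒱 (P := fun x => ∀ {p q : ℤ} {a b : GradedSym 𝒱 →ₗ[F] g},
    IsHomogeneousMap 𝒱 𝒢 p a → (d ∘ₗ GradedSym.cupBracket 𝒱 β q a b) x =
      (GradedSym.cupBracket 𝒱 β q (d ∘ₗ a) b +
        ((-1 : F) ^ p) • GradedSym.cupBracket 𝒱 β (q - 1) a (d ∘ₗ b)) x) ?_ ?_ ?_ ?_ x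
  · intro p q a b ha
    simpa [cupBracket_one] using hd p _ ha.apply_one (b 1)
  · intro x y hx hy p q a b ha
    rw [map_add, map_add, hx ha, hy ha]
  · intro c x hx p q a b ha
    rw [map_smul, map_smul, hx ha]
  · intro i v hv x hx p q a b ha
    have h1 := hx (q := q) (b := b) (ha.precompLetter hv)
    have h2 := hx (q := q + i) (b := GradedSym.precompLetter 𝒱 v b) ha
    have e : ∀ f : GradedSym 𝒱 →ₗ[F] g, GradedSym.precompLetter 𝒱 v (d ∘ₗ f) =
      d ∘ₗ GradedSym.precompLetter 𝒱 v f := fun _ => rfl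
    have s := neg_one_zpow_mul_self (F := F) i
    rw [show q + i - 1 = q - 1 + i by ring] at h2
    simp only [LinearMap.add_apply, LinearMap.smul_apply, LinearMap.comp_apply] at h1 h2 ⊢
    rw [cupBracket_ι_mul 𝒱 β _ _ _ hv, cupBracket_ι_mul 𝒱 β _ _ _ hv,
      cupBracket_ι_mul 𝒱 β _ _ _ hv, map_add, map_smul, h1, h2, e, e, sub_one_mul,
      zpow_sub₀ (show (-1 : F) ≠ 0 by simp), zpow_add₀ (show (-1 : F) ≠ 0 by simp)]
    have s' : ((-1 : F) ^ i)⁻¹ = (-1 : F) ^ i := inv_eq_of_mul_eq_one_left s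
    rw [div_eq_mul_inv, s']
    module

end GradedSym

/-! ### The recursion and the master equation in a differential graded Lie algebra. -/

namespace GradedSym

variable {F V : Type*} [Field F] [AddCommGroup V] [Module F V] {𝒱 : ℤ → Submodule F V}
  [Decomposition 𝒱] {g : Type*} [AddCommGroup g] [Module F g] {β : g →ₗ[F] g →ₗ[F] g}

theorem map_cupBracket {g' : Type*} [AddCommGroup g'] [Module F g'] {β' : g' →ₗ[F] g' →ₗ[F] g'}
    (f : g →ₗ[F] g') (hf : ∀ x y, f (β x y) = β' (f x) (f y)) (q : ℤ)
    (a b : GradedSym 𝒱 →ₗ[F] g) :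
    f ∘ₗ cupBracket 𝒱 β q a b = cupBracket 𝒱 β' q (f ∘ₗ a) (f ∘ₗ b) := by
  refine LinearMap.ext fun x => ?_
  simp only [cupBracket, LinearMap.comp_apply]
  induction comul 𝒱 x using TensorProduct.induction_on with
  | zero => simp
  | add s t hs ht => simp only [map_add, hs, ht]
  | tmul x y => simp [hf]

/-- Meant for operators such as dh + hd + id, which annihilate brackets without being Lie morphisms.
-/
theorem map_cupBracket_eq_zero {W : Type*} [AddCommGroup W] [Module F W]
    (f : g →ₗ[F] W) (hf : ∀ x y, f (β x y) = 0) (q : ℤ) (a b : GradedSym 𝒱 →ₗ[F] g) :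
    f ∘ₗ cupBracket 𝒱 β q a b = 0 := by
  have h : f ∘ₗ TensorProduct.lift β = 0 := TensorProduct.ext' fun x y => by simp [hf]
  rw [cupBracket, ← LinearMap.comp_assoc, h, LinearMap.zero_comp]

/-- A pointwise eventually constant sequence of linear maps has a linear limit. -/
theorem exists_linearMap_eventually_eq {U W : Type*} [AddCommGroup U] [Module F U]
    [AddCommGroup W] [Module F W] (f : ℕ → U →ₗ[F] W)
    (hf : ∀ x, ∃ w, ∀ᶠ n in Filter.atTop, f n x = w) :
    ∃ T : U →ₗ[F] W, ∀ x, ∀ᶠ n in Filter.atTop, f n x = T x := by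
  choose T hT using hf
  refine ⟨⟨⟨T, fun x y => ?_⟩, fun c x => ?_⟩, hT⟩
  · obtain ⟨n, h1, h2, h3⟩ := ((hT x).and ((hT y).and (hT (x + y)))).exists
    rw [← h1, ← h2, ← h3, map_add]
  · obtain ⟨n, h1, h2⟩ := ((hT x).and (hT (c • x))).exists
    change T (c • x) = c • T x
    rw [← h1, ← h2, map_smul]

/-- The solution is the limit of the iterates of `N` at 0, where each iteration settles one more
word length. -/
theorem exists_recursive_solution {𝒢 : ℤ → Submodule F g}
    (hβ : ∀ i j, ∀ x ∈ 𝒢 i, ∀ y ∈ 𝒢 j, β x y ∈ 𝒢 (i + j))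
    (s : GradedSym 𝒱 →ₗ[F] g) (hs : IsHomogeneousMap 𝒱 𝒢 (-1) s) (hs1 : s 1 = 0)
    (h : g →ₗ[F] g) (hh : ∀ n, ∀ x ∈ 𝒢 n, h x ∈ 𝒢 (n + 1)) (c : F) :
    ∃ T : GradedSym 𝒱 →ₗ[F] g, IsHomogeneousMap 𝒱 𝒢 (-1) T ∧ T 1 = 0 ∧
      T = s - h ∘ₗ (c • cupBracket 𝒱 β (-1) T T) := by
  let N : (GradedSym 𝒱 →ₗ[F] g) → (GradedSym 𝒱 →ₗ[F] g) := fun T =>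
    s - h ∘ₗ (c • cupBracket 𝒱 β (-1) T T)
  have hN1 : ∀ T : GradedSym 𝒱 →ₗ[F] g, T 1 = 0 → N T 1 = 0 := fun T hT => by
    simp [N, cupBracket_one, hT, hs1]
  -- The contraction estimate: agreement on lengths below n improves to agreement on lengths below n
  -- + 1.
  have hN : ∀ S T : GradedSym 𝒱 →ₗ[F] g, S 1 = 0 → T 1 = 0 → ∀ n : ℕ,
      (∀ k < n, ∀ x ∈ power 𝒱 k, (S - T) x = 0) →
      ∀ k < n + 1, ∀ x ∈ power 𝒱 k, (N S - N T) x = 0 := by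
    intro S T hS hT n hST k hk x hx
    have e : N S - N T = -(h ∘ₗ (c • (cupBracket 𝒱 β (-1) S S - cupBracket 𝒱 β (-1) T T))) := by
      simp only [N, smul_sub, LinearMap.comp_sub]
      abel
    rw [e, cupBracket_mul_self]
    simp only [LinearMap.neg_apply, LinearMap.comp_apply, LinearMap.smul_apply,
      LinearMap.add_apply]
    rw [cupBracket_eq_zero_of_power 𝒱 β k, cupBracket_eq_zero_of_power 𝒱 β k]
    · simp
    · intro i j hij
      rcases Nat.lt_or_ge j n with hj | hj
      · exact Or.inr (hST j hj)
      -- As i + j = k ≤ n, a second factor of length at least n leaves the empty word to `T`, which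
      -- vanishes there.
      · obtain rfl : i = 0 := by omega
        exact Or.inl (eq_zero_of_mem_power_zero hT)
    · exact hx
    · intro i j hij
      rcases Nat.lt_or_ge i n with hi | hi
      · exact Or.inl (hST i hi)
      · obtain rfl : j = 0 := by omega
        exact Or.inr (eq_zero_of_mem_power_zero hS)
    · exact hx
  let f : ℕ → (GradedSym 𝒱 →ₗ[F] g) := fun n => N^[n] 0
  have f_succ : ∀ n, f (n + 1) = N (f n) := fun n => Function.iterate_succ_apply' N n 0
  have f_one : ∀ n, f n 1 = 0 := fun n => by
    induction n with
    | zero => rfl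
    | succ n ih => rw [f_succ]; exact hN1 _ ih
  have f_hom : ∀ n, IsHomogeneousMap 𝒱 𝒢 (-1) (f n) := fun n => by
    induction n with
    | zero => exact fun k x _ => zero_mem (𝒢 _)
    | succ n ih =>
      rw [f_succ]
      intro k x hx
      refine sub_mem (hs k x hx) ?_
      have := hh _ _ (Submodule.smul_mem _ c (ih.cupBracket hβ ih k x hx))
      rwa [show k + (-1 + -1) + 1 = k + -1 by ring] at this
  have f_step : ∀ n, ∀ k < n, ∀ x ∈ power 𝒱 k, (f (n + 1) - f n) x = 0 := fun n => by
    induction n with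
    | zero => exact fun k hk => absurd hk (Nat.not_lt_zero k)
    | succ n ih =>
      rw [f_succ, f_succ n]
      exact hN _ _ (by rw [← f_succ]; exact f_one _) (f_one n) n (by rw [← f_succ]; exact ih)
  -- The starting map 0 need not be right on any length, so length k is settled from iterate k + 1
  -- on.
  have f_const : ∀ k, ∀ x ∈ power 𝒱 k, ∀ n, k < n → f n x = f (k + 1) x := by
    intro k x hx n hn
    induction n, hn using Nat.le_induction with
    | base => rfl
    | succ n hn ih =>
      rw [← ih, ← sub_eq_zero, ← LinearMap.sub_apply]
      exact f_step n k hn x hx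
  obtain ⟨T, hT⟩ := exists_linearMap_eventually_eq f fun x => by
    have key : x ∈ ⨆ k, power 𝒱 k := by rw [iSup_power]; trivial
    induction key using Submodule.iSup_induction' with
    | zero => exact ⟨0, by simp⟩
    | add x y _ _ hx hy =>
      obtain ⟨u, hu⟩ := hx
      obtain ⟨w, hw⟩ := hy
      exact ⟨u + w, by filter_upwards [hu, hw] with n h1 h2; rw [map_add, h1, h2]⟩
    | mem k x hx =>
      exact ⟨f (k + 1) x, by
        filter_upwards [Filter.eventually_gt_atTop k] with n hn using f_const k x hx n hn⟩
  have T_eq : ∀ n k, k < n → ∀ x ∈ power 𝒱 k, T x = f n x := by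
    intro n k hk x hx
    obtain ⟨m, h1, h2⟩ := ((hT x).and (Filter.eventually_gt_atTop k)).exists
    rw [← h1, f_const k x hx m h2, f_const k x hx n hk]
  have T_one : T 1 = 0 := by
    obtain ⟨m, h1⟩ := (hT 1).exists
    rw [← h1, f_one]
  refine ⟨T, fun n x hx => ?_, T_one, linearMap_ext 𝒱 fun k x hx => ?_⟩
  · obtain ⟨m, h1⟩ := (hT x).exists
    rw [← h1]
    exact f_hom m n x hx
  -- `T` and `f (k + 1)` agree up to length k, hence so do `N T` and `f (k + 2)`; on length k the
  -- latter is already `T`.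
  · have := hN T (f (k + 1)) T_one (f_one _) (k + 1) (fun i hi y hy => by
      rw [LinearMap.sub_apply, T_eq _ i hi y hy, sub_self]) k (by omega) x hx
    rw [LinearMap.sub_apply, sub_eq_zero, ← f_succ, ← T_eq (k + 1 + 1) k (by omega) x hx] at this
    exact this.symm

/-- Put X = [[T, T], T]. Skew symmetry gives [T, [T, T]] = -X, and Jacobi in odd degree then reads
-X = X + X, so 3X = 0. -/
theorem cupBracket_cupBracket_self [CharZero F] {𝒢 : ℤ → Submodule F g}
    (hβ : ∀ i j, ∀ x ∈ 𝒢 i, ∀ y ∈ 𝒢 j, β x y ∈ 𝒢 (i + j))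
    (skew : ∀ i j, ∀ x ∈ 𝒢 i, ∀ y ∈ 𝒢 j, β x y = -(((-1 : F) ^ (i * j)) • β y x))
    (jacobi : ∀ i j, ∀ x ∈ 𝒢 i, ∀ y ∈ 𝒢 j, ∀ z,
      β x (β y z) = β (β x y) z + ((-1 : F) ^ (i * j)) • β y (β x z))
    {T : GradedSym 𝒱 →ₗ[F] g} (hT : IsHomogeneousMap 𝒱 𝒢 (-1) T) :
    cupBracket 𝒱 β (-1) (cupBracket 𝒱 β (-1) T T) T = 0 := by
  have h1 := cupBracket_jacobi jacobi hT hT hT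
  have h2 := cupBracket_skew skew hT (hT.cupBracket hβ hT)
  norm_num at h1 h2
  rw [h2] at h1
  have h3 : (3 : F) • cupBracket 𝒱 β (-1) (cupBracket 𝒱 β (-1) T T) T = 0 := by
    rw [← sub_eq_zero] at h1
    rw [← neg_eq_zero, ← h1]
    module
  exact (smul_eq_zero.1 h3).resolve_left (by norm_num)

/-- The homotopy relation is required only on brackets, where the term ∇π of a contraction drops out
once π kills them. -/
theorem exists_master_equation_solution [CharZero F] {𝒢 : ℤ → Submodule F g}
    (hβ : ∀ i j, ∀ x ∈ 𝒢 i, ∀ y ∈ 𝒢 j, β x y ∈ 𝒢 (i + j))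
    (skew : ∀ i j, ∀ x ∈ 𝒢 i, ∀ y ∈ 𝒢 j, β x y = -(((-1 : F) ^ (i * j)) • β y x))
    (jacobi : ∀ i j, ∀ x ∈ 𝒢 i, ∀ y ∈ 𝒢 j, ∀ z,
      β x (β y z) = β (β x y) z + ((-1 : F) ^ (i * j)) • β y (β x z))
    {d : g →ₗ[F] g} (d_mem : ∀ n, ∀ x ∈ 𝒢 n, d x ∈ 𝒢 (n - 1))
    (hd : ∀ i, ∀ x ∈ 𝒢 i, ∀ y, d (β x y) = β (d x) y + ((-1 : F) ^ i) • β x (d y))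
    (s : GradedSym 𝒱 →ₗ[F] g) (hs : IsHomogeneousMap 𝒱 𝒢 (-1) s) (hs1 : s 1 = 0)
    (ds : d ∘ₗ s = 0)
    (h : g →ₗ[F] g) (hh : ∀ n, ∀ x ∈ 𝒢 n, h x ∈ 𝒢 (n + 1))
    (homotopy : ∀ x y, d (h (β x y)) + h (d (β x y)) = -β x y) :
    ∃ T : GradedSym 𝒱 →ₗ[F] g, IsHomogeneousMap 𝒱 𝒢 (-1) T ∧ T 1 = 0 ∧
      d ∘ₗ T = (1 / 2 : F) • cupBracket 𝒱 β (-1) T T ∧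
      T = s - h ∘ₗ d ∘ₗ T := by
  obtain ⟨T, hT, T1, T_eq⟩ := exists_recursive_solution hβ s hs hs1 h hh (1 / 2 : F)
  have hK := map_cupBracket_eq_zero (𝒱 := 𝒱) (β := β) (d ∘ₗ h + h ∘ₗ d + LinearMap.id)
    (fun x y => by simp [homotopy]) (-1) T T
  have hdT : IsHomogeneousMap 𝒱 𝒢 (-2) (d ∘ₗ T) := fun n x hx => by
    have := d_mem _ _ (hT n x hx)
    rwa [show n + -1 - 1 = n + -2 by ring] at this
  set Q := (1 / 2 : F) • cupBracket 𝒱 β (-1) T T with hQ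
  have hKQ : d ∘ₗ h ∘ₗ Q + h ∘ₗ d ∘ₗ Q + Q = 0 := by
    have h1 := congrArg (fun f => (1 / 2 : F) • f) hK
    simpa only [LinearMap.add_comp, LinearMap.comp_smul, LinearMap.id_comp, smul_add,
      LinearMap.comp_assoc, smul_zero, hQ] using h1
  have dT : d ∘ₗ T = Q + h ∘ₗ d ∘ₗ Q := by
    have h1 : d ∘ₗ T = d ∘ₗ s - d ∘ₗ h ∘ₗ Q := by
      rw [← LinearMap.comp_sub]
      exact congrArg (fun f => d ∘ₗ f) T_eq
    rw [h1, ds, zero_sub, ← sub_eq_zero, ← neg_eq_zero, ← hKQ]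
    abel
  -- In degrees -1 and -2 skew symmetry gives [T, dT] = -[dT, T]; the two terms of the derivation
  -- rule therefore coincide and cancel the factor ½.
  have dQ : d ∘ₗ Q = cupBracket 𝒱 β (-1) (d ∘ₗ T) T := by
    have h1 := cupBracket_derivation (q := -1) (b := T) hd hT
    have h2 := cupBracket_skew skew hT hdT
    norm_num at h1 h2
    rw [hQ, LinearMap.comp_smul, h1, h2]
    module
  -- Because [Q, T] = 0, subtracting `Q` from `d ∘ₗ T` does not change the bracket with `T`.
  have hΦ : d ∘ₗ T - Q = h ∘ₗ cupBracket 𝒱 β (-1) (d ∘ₗ T - Q) T := by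
    have h1 := cupBracket_add_left 𝒱 β (-1) (d ∘ₗ T - Q) Q T
    have h2 : cupBracket 𝒱 β (-1) Q T = 0 := by
      rw [hQ, cupBracket_smul_left, cupBracket_cupBracket_self hβ skew jacobi hT, smul_zero]
    rw [sub_add_cancel, h2, add_zero] at h1
    rw [← h1, ← dQ, sub_eq_iff_eq_add']
    exact dT
  have hz : d ∘ₗ T - Q = 0 := by
    refine linearMap_ext 𝒱 fun k => ?_
    induction k using Nat.strong_induction_on with
    | _ k ih =>
      intro x hx
      rw [hΦ, LinearMap.comp_apply, cupBracket_eq_zero_of_power 𝒱 β k _ _ _ ?_ x hx]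
      · simp
      · intro i j hij
        rcases Nat.lt_or_ge i k with hi | hi
        · exact Or.inl (ih i hi)
        -- If Φ receives the whole word, then `T` is evaluated on the empty word, where it is zero.
        · obtain rfl : j = 0 := by omega
          exact Or.inr (eq_zero_of_mem_power_zero T1)
  have hdTQ := sub_eq_zero.1 hz
  -- The master equation allows `d ∘ₗ T` to replace ½[T, T] in the recursion.
  exact ⟨T, hT, T1, hdTQ, by rw [hdTQ]; exact T_eq⟩

theorem proj₁_isHomogeneousMap (𝒱 : ℤ → Submodule F V) :
    IsHomogeneousMap 𝒱 𝒱 0 (proj₁ 𝒱) := by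
  intro n x hx
  induction hx using Submodule.span_induction with
  | zero => rw [map_zero]; exact zero_mem _
  | add x y _ _ hx hy => rw [map_add]; exact add_mem hx hy
  | smul c x _ hx => rw [map_smul]; exact Submodule.smul_mem _ c hx
  | mem x hx =>
    obtain ⟨l, rfl, rfl⟩ := hx
    match l with
    | [] => simp [proj₁_one]
    | [p] => simp [proj₁_ι]
    | p :: p' :: l =>
      simp only [List.map_cons, List.prod_cons, proj₁_ι_mul_ι_mul]
      exact zero_mem _

end GradedSym

/-! ### The Lie algebra Ker Δ and its projection to homology. -/

namespace DifferentialBVAlgebra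

set_option linter.unusedSectionVars false

variable {F A : Type*} [Field F] [NonUnitalRing A] [Module F A] [IsScalarTower F A A]
  [SMulCommClass F A A] {𝒜 : ℤ → Submodule F A} (B : DifferentialBVAlgebra 𝒜)

theorem bracket_eq_Δ [Decomposition 𝒜] {x y : A} (hx : x ∈ B.m) (hy : y ∈ B.m) :
    B.bracket x y = B.Δ (koszulSign 𝒜 1 x * y) := by
  -- Stated for every `x`, because the induction over homogeneous components does not carry the
  -- condition Δx = 0.
  have key : ∀ x : A, B.bracket x y =
      B.Δ (koszulSign 𝒜 1 x * y) + koszulSign 𝒜 1 (B.Δ x) * y - x * B.Δ y := by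
    intro x
    induction x using Decomposition.inductionOn 𝒜 with
    | zero => simp
    | add s t hs ht =>
      simp only [map_add, LinearMap.add_apply, add_mul, hs, ht]
      abel
    | @homogeneous i x =>
      rw [B.bracket_eq i x x.2, koszulSign_of_mem 𝒜 1 x.2,
        koszulSign_of_mem 𝒜 1 (B.Δ_mem i x x.2), one_mul, one_mul, smul_mul_assoc, map_smul,
        smul_mul_assoc, zpow_sub_one₀ (by simp)]
      have hs := GradedSym.neg_one_zpow_mul_self (F := F) i
      simp only [smul_sub, smul_smul, hs]
      module
  rw [key, LinearMap.mem_ker.1 hx, LinearMap.mem_ker.1 hy]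
  simp

theorem Δ_apply_mem (x : A) : B.Δ x ∈ B.m := LinearMap.congr_fun B.Δ_Δ x

/-- The bracket of `m = Ker Δ`. -/
def mBracket [Decomposition 𝒜] : B.m →ₗ[F] B.m →ₗ[F] B.m :=
  LinearMap.mk₂ F
    (fun x y => ⟨B.bracket x y, by rw [B.bracket_eq_Δ x.2 y.2]; exact B.Δ_apply_mem _⟩)
    (fun x x' y => Subtype.ext (by simp))
    (fun c x y => Subtype.ext (by simp))
    (fun x y y' => Subtype.ext (by simp))
    (fun c x y => Subtype.ext (by simp))

theorem coe_mBracket [Decomposition 𝒜] (x y : B.m) : (B.mBracket x y : A) = B.bracket x y := rfl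

theorem homologyClass_Δ_eq_zero_iff (x : B.m) :
    homologyClass B.Δ x = 0 ↔ (x : A) ∈ LinearMap.range B.Δ :=
  Submodule.Quotient.mk_eq_zero _

theorem homologyClass_mBracket [Decomposition 𝒜] (x y : B.m) :
    homologyClass B.Δ (B.mBracket x y) = 0 :=
  (B.homologyClass_Δ_eq_zero_iff _).2 ⟨_, (B.bracket_eq_Δ x.2 y.2).symm⟩

-- After the projection to H(g, Δ) only isomorphisms follow. This one equivalence shows both that π
-- kills brackets and that τ_k lands in Im Δ for k ≥ 2.
variable {B} in
theorem proj_eq_zero_iff (hB : B.KahlerFormality) (x : B.m) :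
    proj hB x = 0 ↔ (x : A) ∈ LinearMap.range B.Δ := by
  rw [← B.homologyClass_Δ_eq_zero_iff, proj]
  simp only [LinearMap.comp_apply, LinearEquiv.coe_coe, LinearEquiv.map_eq_zero_iff]

-- Classes have representatives in Ker Δ by surjectivity of H(m) → H(g). The bracket of two such
-- lies in Im Δ, so its class dies in H(g, Δ), hence already in H(m) by injectivity.
variable {B} in
theorem homologyBracket_eq_zero [Decomposition 𝒜] (hB : B.KahlerFormality) (x y : B.H) :
    B.homologyBracket x y = 0 := by
  obtain ⟨x, rfl⟩ := hB.incl_bijective.2 x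
  obtain ⟨y, rfl⟩ := hB.incl_bijective.2 y
  obtain ⟨x, rfl⟩ := Submodule.mkQ_surjective _ x
  obtain ⟨y, rfl⟩ := Submodule.mkQ_surjective _ y
  have hd : ∀ z : LinearMap.ker B.dm, B.d ((z : B.m) : A) = 0 := fun z =>
    congrArg Subtype.val (LinearMap.mem_ker.1 z.2)
  have hz : B.mBracket x y ∈ LinearMap.ker B.dm := by
    refine LinearMap.mem_ker.2 (Subtype.ext ?_)
    change B.d (B.bracket _ _) = 0
    rw [B.d_bracket', hd, hd]
    simp
  have h0 : homologyClass B.dm ⟨B.mBracket x y, hz⟩ = 0 :=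
    hB.proj_bijective.1 ((B.homologyClass_mBracket x y).trans (map_zero _).symm)
  exact (congrArg B.inclHomology h0).trans (map_zero _)

theorem dm_mem (n : ℤ) (x : B.m) (hx : x ∈ B.mGrading n) : B.dm x ∈ B.mGrading (n - 1) := by
  have h := B.d_mem (1 - n) x hx
  rwa [show 1 - n + 1 = 1 - (n - 1) by ring] at h

theorem mBracket_mem [Decomposition 𝒜] (i j : ℤ) (x : B.m) (hx : x ∈ B.mGrading i) (y : B.m)
    (hy : y ∈ B.mGrading j) : B.mBracket x y ∈ B.mGrading (i + j) := by
  have h := B.bracket_mem (1 - i) (1 - j) x hx y hy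
  rwa [show 1 - i + (1 - j) - 1 = 1 - (i + j) by ring] at h

theorem mBracket_skew [Decomposition 𝒜] (i j : ℤ) (x : B.m) (hx : x ∈ B.mGrading i) (y : B.m)
    (hy : y ∈ B.mGrading j) :
    B.mBracket x y = -(((-1 : F) ^ (i * j)) • B.mBracket y x) := by
  have h := B.bracket_skew (1 - i) (1 - j) x hx y hy
  rw [show (1 - i - 1) * (1 - j - 1) = i * j by ring] at h
  exact Subtype.ext h

theorem mBracket_jacobi [Decomposition 𝒜] (i j : ℤ) (x : B.m) (hx : x ∈ B.mGrading i) (y : B.m)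
    (hy : y ∈ B.mGrading j) (z : B.m) :
    B.mBracket x (B.mBracket y z) = B.mBracket (B.mBracket x y) z +
      ((-1 : F) ^ (i * j)) • B.mBracket y (B.mBracket x z) := by
  have h := B.bracket_jacobi (1 - i) (1 - j) x hx y hy z
  rw [show (1 - i - 1) * (1 - j - 1) = i * j by ring] at h
  exact Subtype.ext h

/-- The regrading turns the sign -(-1)^(1-i) of `d_bracket` into (-1)^i. -/
theorem dm_mBracket [Decomposition 𝒜] (i : ℤ) (x : B.m) (hx : x ∈ B.mGrading i) (y : B.m) :
    B.dm (B.mBracket x y) = B.mBracket (B.dm x) y + ((-1 : F) ^ i) • B.mBracket x (B.dm y) := by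
  have h := B.d_bracket (1 - i) x hx y
  have hs := GradedSym.neg_one_zpow_mul_self (F := F) i
  rw [zpow_sub₀ (by simp), zpow_one, div_eq_mul_inv, inv_eq_of_mul_eq_one_left hs, neg_one_mul,
    neg_smul, sub_neg_eq_add] at h
  exact Subtype.ext h

theorem universalTwistingCochain_isHomogeneousMap :
    GradedSym.IsHomogeneousMap (suspend B.HGrading) B.HGrading (-1) B.universalTwistingCochain :=
  fun n x hx => by
    have h := GradedSym.proj₁_isHomogeneousMap _ n x hx
    rwa [mem_suspend, add_zero] at h

end DifferentialBVAlgebra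

/-! ### The twisting cochain of a differential BV-algebra. -/

theorem theorem3 {F A : Type*} [Field F] [CharZero F] [NonUnitalRing A] [Module F A]
    [IsScalarTower F A A] [SMulCommClass F A A] (𝒜 : ℤ → Submodule F A)
    [DirectSum.Decomposition 𝒜] (B : DifferentialBVAlgebra 𝒜) (hB : B.KahlerFormality)
    (c : Contraction B.dm B.mGrading (0 : B.H →ₗ[F] B.H) B.HGrading)
    (hc : c.π = DifferentialBVAlgebra.proj hB) :
    (∀ x y : B.H, B.homologyBracket x y = 0) ∧
    ∃ τ : GradedSym (suspend B.HGrading) →ₗ[F] A,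
      (∀ n, ∀ x ∈ GradedSym.degree (suspend B.HGrading) n, τ x ∈ lieGrading 𝒜 (n - 1)) ∧
      τ 1 = 0 ∧
      B.d ∘ₗ τ = (1 / 2 : F) •
        GradedSym.cupBracket (suspend B.HGrading) B.bracket (-1) τ τ ∧
      B.Δ ∘ₗ τ = 0 ∧
      (∃ T : GradedSym (suspend B.HGrading) →ₗ[F] B.m,
        B.m.subtype ∘ₗ T = τ ∧
        c.π ∘ₗ T = B.universalTwistingCochain ∧
        T = c.nabla ∘ₗ B.universalTwistingCochain - c.h ∘ₗ B.dm ∘ₗ T) ∧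
      ∀ k, 2 ≤ k → ∀ x ∈ GradedSym.power (suspend B.HGrading) k, τ x ∈ LinearMap.range B.Δ := by
  refine ⟨B.homologyBracket_eq_zero hB, ?_⟩
  have π_bracket : ∀ x y, c.π (B.mBracket x y) = 0 := fun x y => by
    rw [hc, DifferentialBVAlgebra.proj_eq_zero_iff, ← B.homologyClass_Δ_eq_zero_iff]
    exact B.homologyClass_mBracket x y
  obtain ⟨T, hT, T_one, dT, T_eq⟩ := GradedSym.exists_master_equation_solution
    (𝒱 := suspend B.HGrading) B.mBracket_mem B.mBracket_skew B.mBracket_jacobi B.dm_mem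
    B.dm_mBracket (c.nabla ∘ₗ B.universalTwistingCochain)
    (fun n x hx => c.nabla_mem _ _ (B.universalTwistingCochain_isHomogeneousMap n x hx))
    (by
      rw [LinearMap.comp_apply, DifferentialBVAlgebra.universalTwistingCochain,
        GradedSym.proj₁_one, map_zero])
    (by rw [← LinearMap.comp_assoc, c.nabla_chain, LinearMap.comp_zero, LinearMap.zero_comp])
    c.h c.h_mem
    (fun x y => by
      have h := LinearMap.congr_fun c.homotopy (B.mBracket x y)
      simpa [π_bracket] using h)
  have πT : c.π ∘ₗ T = B.universalTwistingCochain := by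
    rw [T_eq, LinearMap.comp_sub, ← LinearMap.comp_assoc, c.π_nabla, ← LinearMap.comp_assoc,
      c.π_h, LinearMap.zero_comp, sub_zero, LinearMap.id_comp]
  refine ⟨B.m.subtype ∘ₗ T, fun n x hx => hT n x hx, ?_, ?_, ?_, ⟨T, rfl, πT, T_eq⟩, ?_⟩
  · rw [LinearMap.comp_apply, T_one, map_zero]
  · have h := congrArg (fun f => B.m.subtype ∘ₗ f) dT
    simp only [LinearMap.comp_smul] at h
    -- The inclusion of m preserves brackets and so carries the master equation from m to g.
    rw [GradedSym.map_cupBracket (β := B.mBracket) (β' := B.bracket) B.m.subtype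
      B.coe_mBracket] at h
    exact h
  · exact LinearMap.ext fun x => (T x).2
  · intro k hk x hx
    refine (DifferentialBVAlgebra.proj_eq_zero_iff hB (T x)).1 ?_
    rw [← hc]
    exact (LinearMap.congr_fun πT x).trans (GradedSym.proj₁_power _ k (by omega) x hx)
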